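/- **Theorem 1.1 (Sub-exponential growth and CLT).** *Setting.* Let $H$ be a locally compact second countable group with left-invariant Haar measure $m_H$ and a proper left-invariant metric $d$ inducing the topology of $H$, and let $B_d(e,r)$ be the $d$-ball of radius $r$ around the identity $e$. Let $H$ act jointly measurably by measure-preserving maps on a probability space $(X,\mu)$. Write $\mu(f)=\int_X f\,d\mu$ and $h\cdot f=f\circ h^{-1}$. Let $\mathcal A$ be an $H$-invariant (not necessarily unital) sub-algebra of the real algebra $L^\infty(X,\mu)$, and let $(N_s)_{s\ge 1}$ be semi-norms on $\mathcal A$ such that for every integer $s\ge 1$ there are constants $c_s$ and $\sigma_s>0$ with, for all $f,f_1,f_2\in\mathcal A$ and $h\in H$, $$N_s(f)\le c_sN_{s+1}(f),\qquad \|f\|_{L^\infty}\le c_sN_s(f),$$ $$N_s(h\cdot f)\le c_s e^{\sigma_s d(h,e)}N_s(f),\qquad N_s(f_1f_2)\le c_sN_{s+1}(f_1)N_{s+1}(f_2).$$ Suppose that the action is *exponentially mixing of all orders* with respect to $d$ and $(\mathcal A,(N_s))$: for every integer $r\ge 2$ there are $\delta_r>0$ and an integer $s_r>0$ such that for every $s>s_r$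 there is a constant $c_{r,s}$ with $$\Big|\mu\Big(\prod_{i=1}^r h_i\cdot f_i\Big)-\prod_{i=1}^r\mu(f_i)\Big|\le c_{r,s}\,e^{-\delta_r\min_{i\ne j}d(h_i,h_j)}\prod_{i=1}^rN_s(f_i)$$ for all $f_1,\dots,f_r\in\mathcal A$ and $h_1,\dots,h_r\in H$. Suppose that $(H,d)$ has *sub-exponential growth*, i.e. $\limsup_{r\to\infty}\frac1r\log m_H(B_d(e,r))=0$, and let $(F_T)_{T\in\mathbb N}$ be a *right Følner sequence*, i.e. a sequence of compact subsets of $H$ with non-empty interiors such that $m_H(F_T\,\triangle\,F_Th)/m_H(F_T)\to0$ as $T\to\infty$ for every $h\in H$. Assume that $m_H(F_T)\to\infty$. *Conclusion.* For every $f\in\mathcal A$ with $\mu(f)=0$, the function $h\mapsto\langle f,f\circ h^{-1}\rangle=\int_X f(x)f(h^{-1}x)\,d\mu(x)$ is integrable on $H$, the number $$\sigma_f^2:=\int_H\langle f,f\circ h^{-1}\rangle\,dm_H(h)$$ is finite and non-negative, and $$\frac1{m_H(F_T)^{1/2}}\int_{F_T}(f\circ h^{-1})\,dm_H(h)\Longrightarrow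 N(0,\sigma_f^2)\qquad(T\to\infty)$$ in distribution, where $N(0,0)$ is the point mass at $0$. -/

import Mathlib

open MeasureTheory ProbabilityTheory Filter Topology
open scoped ENNReal

noncomputable section

/-- Sub-exponential growth of a group `H` with metric `dist` and Haar measure `m`:
`limsup_{r → ∞} log m(B(e, r)) / r = 0`. The limsup is taken in the extended reals, so that it
is not zero by default when the quotients are unbounded. -/
def SubexponentialGrowth (H : Type*) [Group H] [MetricSpace H] [MeasurableSpace H]
    (m : Measure H) : Prop :=
  limsup (fun r : ℝ => ((Real.log (m.real (Metric.ball (1 : H) r)) / r : ℝ) : EReal)) atTop = 0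

/-- A right Følner sequence: compact sets with non-empty interiors such that
`m(F_T ∆ F_T h) / m(F_T) → 0` for every `h`. -/
structure IsRightFolner {H : Type*} [Group H] [TopologicalSpace H] [MeasurableSpace H]
    (m : Measure H) (F : ℕ → Set H) : Prop where
  isCompact : ∀ T, IsCompact (F T)
  interior_nonempty : ∀ T, (interior (F T)).Nonempty
  tendsto_symmDiff : ∀ h : H,
    Tendsto (fun T => m (symmDiff (F T) ((fun x => x * h) '' F T)) / m (F T)) atTop (𝓝 0)

/-- The translate `h • f = f ∘ h⁻¹` of a class `f` of bounded functions. -/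
def linftyTranslate {H X : Type*} [Group H] [MeasurableSpace H] [MeasurableSpace X] [MulAction H X]
    [MeasurableSMul H X] {μ : Measure X} [SMulInvariantMeasure H X μ]
    (h : H) (f : Lp ℝ ∞ μ) : Lp ℝ ∞ μ :=
  Lp.compMeasurePreserving (fun x => h⁻¹ • x) (measurePreserving_smul h⁻¹ μ) f

/-- The pointwise product of two classes of bounded functions. -/
def linftyMul {X : Type*} [MeasurableSpace X] {μ : Measure X} (f g : Lp ℝ ∞ μ) : Lp ℝ ∞ μ :=
  f • g

theorem linftyTranslate_ae_eq {H X : Type*} [Group H] [MeasurableSpace H] [MeasurableSpace X]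
    [MulAction H X] [MeasurableSMul H X] {μ : Measure X} [SMulInvariantMeasure H X μ]
    (h : H) (f : Lp ℝ ∞ μ) : ⇑(linftyTranslate h f) =ᵐ[μ] fun x => f (h⁻¹ • x) :=
  Lp.coeFn_compMeasurePreserving _ _

theorem linftyMul_ae_eq {X : Type*} [MeasurableSpace X] {μ : Measure X} (f g : Lp ℝ ∞ μ) :
    ⇑(linftyMul f g) =ᵐ[μ] fun x => f x * g x :=
  Lp.coeFn_lpSMul f g

/-- An `H`-invariant sub-algebra of the real algebra `L^∞(X, μ)`. It need not contain the
constants: smooth functions with compact support on a non-compact manifold are a typical case. -/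
structure InvariantSubalgebra (H : Type*) {X : Type*} [Group H] [MeasurableSpace H]
    [MeasurableSpace X] [MulAction H X] [MeasurableSMul H X] (μ : Measure X)
    [SMulInvariantMeasure H X μ] extends Submodule ℝ (Lp ℝ ∞ μ) where
  mul_mem : ∀ {f g : Lp ℝ ∞ μ}, f ∈ toSubmodule → g ∈ toSubmodule → linftyMul f g ∈ toSubmodule
  translate_mem : ∀ (h : H) {f : Lp ℝ ∞ μ}, f ∈ toSubmodule → linftyTranslate h f ∈ toSubmodule

/-- The four conditions on a family `(N_s)`, `s ≥ 1`, of semi-norms on the algebra `A`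
(the member with index `0` plays no role). -/
structure IsSobolevFamily {H X : Type*} [Group H] [MetricSpace H] [MeasurableSpace H]
    [MeasurableSpace X] [MulAction H X] [MeasurableSMul H X] {μ : Measure X}
    [SMulInvariantMeasure H X μ] (A : InvariantSubalgebra H μ)
    (N : ℕ → Seminorm ℝ A.toSubmodule) : Prop where
  /-- Monotonicity -/
  mono : ∀ s, 1 ≤ s → ∃ c : ℝ, ∀ f : A.toSubmodule, N s f ≤ c * N (s + 1) f
  /-- Sobolev embedding -/
  sobolev : ∀ s, 1 ≤ s → ∃ c : ℝ, ∀ f : A.toSubmodule, ‖(f : Lp ℝ ∞ μ)‖ ≤ c * N s f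
  /-- Boundedness of the action -/
  bounded : ∀ s, 1 ≤ s → ∃ σ : ℝ, 0 < σ ∧ ∃ c : ℝ, ∀ (f : A.toSubmodule) (h : H),
    N s ⟨linftyTranslate h f, A.translate_mem h f.2⟩ ≤ c * Real.exp (σ * dist h 1) * N s f
  /-- Almost multiplicativity -/
  mul : ∀ s, 1 ≤ s → ∃ c : ℝ, ∀ f g : A.toSubmodule,
    N s ⟨linftyMul (f : Lp ℝ ∞ μ) g, A.mul_mem f.2 g.2⟩ ≤ c * (N (s + 1) f * N (s + 1) g)

/-- `d_r(h_1, …, h_r) = min_{i ≠ j} d(h_i, h_j)` (used for `r ≥ 2`). -/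
def minDist {H : Type*} [MetricSpace H] {r : ℕ} (h : Fin r → H) : ℝ :=
  ⨅ p : {p : Fin r × Fin r // p.1 ≠ p.2}, dist (h p.1.1) (h p.1.2)

/-- Exponential mixing of order `r` with respect to the metric and `(A, N)`. -/
def ExponentiallyMixingOfOrder {H X : Type*} [Group H] [MetricSpace H] [MeasurableSpace H]
    [MeasurableSpace X] [MulAction H X] [MeasurableSMul H X] {μ : Measure X}
    [SMulInvariantMeasure H X μ] (A : InvariantSubalgebra H μ)
    (N : ℕ → Seminorm ℝ A.toSubmodule) (r : ℕ) : Prop :=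
  ∃ δ : ℝ, 0 < δ ∧ ∃ s₀ : ℕ, 0 < s₀ ∧ ∀ s, s₀ < s → ∃ c : ℝ,
    ∀ (f : Fin r → A.toSubmodule) (h : Fin r → H),
      |∫ x, ∏ i, (f i : Lp ℝ ∞ μ) ((h i)⁻¹ • x) ∂μ - ∏ i, ∫ x, (f i : Lp ℝ ∞ μ) x ∂μ| ≤
        c * Real.exp (-δ * minDist h) * ∏ i, N s (f i)

/-- Exponential mixing of all orders. -/
def ExponentiallyMixing {H X : Type*} [Group H] [MetricSpace H] [MeasurableSpace H]
    [MeasurableSpace X] [MulAction H X] [MeasurableSMul H X] {μ : Measure X}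
    [SMulInvariantMeasure H X μ] (A : InvariantSubalgebra H μ)
    (N : ℕ → Seminorm ℝ A.toSubmodule) : Prop :=
  ∀ r, 2 ≤ r → ExponentiallyMixingOfOrder A N r

/-- The correlation `⟨f, f ∘ h⁻¹⟩`. -/
def autocorrelation {H X : Type*} [Group H] [MeasurableSpace X] [MulAction H X]
    {μ : Measure X} (f : Lp ℝ ∞ μ) (h : H) : ℝ :=
  ∫ x, f x * f (h⁻¹ • x) ∂μ

/-- The normalised average `m(F)^{-1/2} ∫_F f(h⁻¹ x) dm(h)`. -/
def normalizedAverage {H X : Type*} [Group H] [MeasurableSpace H] [MeasurableSpace X]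
    [MulAction H X] {μ : Measure X} (m : Measure H) (F : Set H) (f : Lp ℝ ∞ μ) (x : X) : ℝ :=
  (Real.sqrt (m.real F))⁻¹ * ∫ h in F, f (h⁻¹ • x) ∂m

end

/-! The proof is by the method of moments. Write `V = m(F)`, let `S` be the integral of the
translates of `f` over `F`, and let `Z = S / √V`. It suffices that `E Z² → σ²` and that the moments
satisfy the Gaussian recursion `E Z^n ≈ (n - 1) E Z² E Z^(n-2)` asymptotically
(`tendstoInDistribution_gaussianReal_of_moment`).

By Fubini the error in this recursion for `S` is the integral over `F^n` of `wickDefect`, the joint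
moment at `(h_1, …, h_n)` minus the sum over all pairings of a fixed index `o` with another one
(`integral_wickDefect`). Group the points `h_i` into clusters at scale `R`. If some point is alone,
every term is small because `f` has mean zero. If the cluster of `o` is a pair `{o, p}`, the term of
`p` cancels the full moment and the other terms are small. Otherwise every cluster has at least two
points and one has three, so there are fewer than `n/2` clusters; such tuples fill a volume at most
`√V^(n-1)` times powers of the volume of a ball of radius `O(R)` (`measure_pi_clustered_le`). With
`R` a multiple of `log V`, subexponential growth makes these ball volumes smaller than any power of
`V`, while the errors `exp(-R/K)` beat `V^n` (`SubexponentialGrowth.exists_radius`).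

The smallness rests on `ExponentiallyMixing.abs_jointMoment_union_sub_le`. Mixing applied to
products over clusters loses a factor exponential in the cluster radius, since the norms grow under
translation. Clustering at a well-chosen scale makes the separation a large multiple of the radius,
which absorbs the loss.

For the variance, `E S² / V` is the integral of the autocorrelation against weights that tend to 1
by the Følner property. Mixing of order two and subexponential growth make the autocorrelation
integrable, so dominated convergence applies. -/

/-! ### Gaussian moments and the method of moments -/

/-- The derivative of each Taylor remainder is `ε` times the previous remainder, so the bound
propagates by comparing derivatives. A general `ε` covers both `I` and `-I`, hence both signs of the
argument. -/
theorem norm_exp_mul_sub_taylor_le {ε : ℂ} (hre : ε.re = 0) (hε : ‖ε‖ = 1) (n : ℕ) :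
    ∀ x : ℝ, 0 ≤ x →
      ‖Complex.exp (x * ε) - ∑ k ∈ Finset.range n, (x * ε) ^ k / (k.factorial : ℂ)‖ ≤
        x ^ n / n.factorial := by
  induction n with
  | zero =>
    intro x _
    simp [Complex.norm_exp, hre]
  | succ n ih =>
    intro x hx
    have hder : ∀ y : ℝ, HasDerivAt
        (fun y : ℝ => Complex.exp (y * ε) -
          ∑ k ∈ Finset.range (n + 1), ((y : ℂ) * ε) ^ k / (k.factorial : ℂ))
        (ε * (Complex.exp (y * ε) - ∑ k ∈ Finset.range n, (y * ε) ^ k / (k.factorial : ℂ))) y := by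
      intro y
      have hlin : HasDerivAt (fun y : ℝ => (y : ℂ) * ε) ε y := by
        simpa using (Complex.ofRealCLM.hasDerivAt (x := y)).mul_const ε
      have hs : HasDerivAt (fun y : ℝ => ∑ k ∈ Finset.range (n + 1),
          ((y : ℂ) * ε) ^ k / (k.factorial : ℂ))
          (∑ k ∈ Finset.range (n + 1), (k * ((y : ℂ) * ε) ^ (k - 1) * ε) / (k.factorial : ℂ)) y :=
        HasDerivAt.fun_sum fun k _ => (hlin.pow k).div_const _
      have hsum : (∑ k ∈ Finset.range (n + 1),
          (k * ((y : ℂ) * ε) ^ (k - 1) * ε) / (k.factorial : ℂ)) =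
          ε * ∑ k ∈ Finset.range n, (y * ε) ^ k / (k.factorial : ℂ) := by
        rw [Finset.sum_range_succ', Finset.mul_sum]
        simp only [Nat.cast_zero, zero_mul, zero_div, add_zero]
        refine Finset.sum_congr rfl fun k _ => ?_
        have h1 : ((k + 1 : ℕ) : ℂ) ≠ 0 := by exact_mod_cast Nat.succ_ne_zero k
        have h2 : (k.factorial : ℂ) ≠ 0 := by exact_mod_cast k.factorial_ne_zero
        rw [Nat.factorial_succ, Nat.add_sub_cancel]
        push_cast at h1 ⊢
        field_simp
      rw [hsum] at hs
      exact (hlin.cexp.fun_sub hs).congr_deriv (by ring)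
    have hB : ∀ y : ℝ, HasDerivAt (fun y : ℝ => y ^ (n + 1) / ((n + 1).factorial : ℝ))
        (y ^ n / (n.factorial : ℝ)) y := by
      intro y
      refine ((hasDerivAt_pow (n + 1) y).div_const ((n + 1).factorial : ℝ)).congr_deriv ?_
      rw [Nat.factorial_succ, Nat.add_sub_cancel]
      have : (n.factorial : ℝ) ≠ 0 := by exact_mod_cast n.factorial_ne_zero
      push_cast
      field_simp
    refine image_norm_le_of_norm_deriv_right_le_deriv_boundary
      (f := fun y : ℝ => Complex.exp (y * ε) -
          ∑ k ∈ Finset.range (n + 1), ((y : ℂ) * ε) ^ k / (k.factorial : ℂ)) (a := 0) (b := x)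
      (fun y _ => (hder y).continuousAt.continuousWithinAt)
      (fun y _ => (hder y).hasDerivWithinAt) ?_ hB ?_ ⟨hx, le_rfl⟩
    · simp [Finset.sum_range_succ', zero_pow]
    · intro y hy
      rw [norm_mul, hε, one_mul]
      exact ih y hy.1

theorem norm_exp_mul_I_sub_taylor_le (x : ℝ) (n : ℕ) :
    ‖Complex.exp (x * Complex.I) -
      ∑ k ∈ Finset.range n, (x * Complex.I) ^ k / (k.factorial : ℂ)‖ ≤ |x| ^ n / n.factorial := by
  rcases le_total 0 x with hx | hx
  · rw [abs_of_nonneg hx]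
    exact norm_exp_mul_sub_taylor_le (by simp) (by simp) n x hx
  · rw [abs_of_nonpos hx]
    have := norm_exp_mul_sub_taylor_le (ε := -Complex.I) (by simp) (by simp) n (-x) (by linarith)
    simpa using this

/-- The moments of the centred Gaussian law of variance `v`. -/
noncomputable def gaussianMoment (v : ℝ) : ℕ → ℝ
  | 0 => 1
  | 1 => 0
  | r + 2 => (r + 1) * v * gaussianMoment v r

theorem gaussianMoment_even (v : ℝ) (n : ℕ) :
    gaussianMoment v (2 * n) / ((2 * n).factorial : ℝ) = (v / 2) ^ n / n.factorial := by
  induction n with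
  | zero => simp [gaussianMoment]
  | succ n ih =>
    have h1 : ((2 * n).factorial : ℝ) ≠ 0 := by exact_mod_cast (2 * n).factorial_ne_zero
    have h2 : (n.factorial : ℝ) ≠ 0 := by exact_mod_cast n.factorial_ne_zero
    have e : 2 * (n + 1) = 2 * n + 2 := by ring
    rw [div_eq_div_iff h1 h2] at ih
    rw [e, gaussianMoment, Nat.factorial_succ, Nat.factorial_succ, Nat.factorial_succ]
    push_cast
    have h3 : (n : ℝ) + 1 ≠ 0 := by positivity
    have h4 : (2 * (n : ℝ) + 1) ≠ 0 := by positivity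
    rw [div_eq_div_iff (by positivity) (by positivity), pow_succ]
    linear_combination ((2 * (n : ℝ) + 1) * v * (n + 1)) * ih

theorem gaussianMoment_odd (v : ℝ) (n : ℕ) : gaussianMoment v (2 * n + 1) = 0 := by
  induction n with
  | zero => simp [gaussianMoment]
  | succ n ih =>
    have e : 2 * (n + 1) + 1 = (2 * n + 1) + 2 := by ring
    rw [e, gaussianMoment, ih, mul_zero]

/-- Odd moments vanish and the even ones turn the Taylor polynomial of `exp(itZ)` into a partial sum
of the series of `exp(-v t² / 2)`. -/
theorem sum_gaussianMoment (v t : ℝ) (n : ℕ) :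
    ∑ k ∈ Finset.range (2 * n), (t * Complex.I) ^ k / (k.factorial : ℂ) * gaussianMoment v k =
      ∑ j ∈ Finset.range n, (((-(v * t ^ 2 / 2) : ℝ) : ℂ)) ^ j / (j.factorial : ℂ) := by
  induction n with
  | zero => simp
  | succ n ih =>
    have e : 2 * (n + 1) = 2 * n + 1 + 1 := by ring
    rw [e, Finset.sum_range_succ, Finset.sum_range_succ, ih, Finset.sum_range_succ,
      gaussianMoment_odd]
    simp only [Complex.ofReal_zero, mul_zero, add_zero]
    congr 1
    have h := congrArg (fun x : ℝ => (x : ℂ)) (gaussianMoment_even v n)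
    push_cast at h
    have : (t * Complex.I : ℂ) ^ (2 * n) = (-(t : ℂ) ^ 2) ^ n := by
      rw [pow_mul, mul_pow, Complex.I_sq]; ring
    rw [this, div_mul_eq_mul_div, mul_div_assoc, h]
    push_cast
    rw [mul_div_assoc', ← mul_pow]
    congr 2
    ring

theorem tendsto_moment_gaussianMoment {X : Type*} [MeasurableSpace X] {μ : Measure X}
    [IsProbabilityMeasure μ] {Z : ℕ → X → ℝ} {v : ℝ}
    (h1 : ∀ T, ∫ x, Z T x ∂μ = 0) (h2 : Tendsto (fun T => ∫ x, Z T x ^ 2 ∂μ) atTop (𝓝 v))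
    (h3 : ∀ r : ℕ, Tendsto (fun T => ∫ x, Z T x ^ (r + 2) ∂μ -
      (r + 1) * ((∫ x, Z T x ^ 2 ∂μ) * ∫ x, Z T x ^ r ∂μ)) atTop (𝓝 0)) (r : ℕ) :
    Tendsto (fun T => ∫ x, Z T x ^ r ∂μ) atTop (𝓝 (gaussianMoment v r)) := by
  induction r using Nat.twoStepInduction with
  | zero => simp [gaussianMoment]
  | one => simp [gaussianMoment, h1]
  | more r ih _ =>
    have := (h3 r).add ((h2.mul ih).const_mul (r + 1 : ℝ))
    simpa [gaussianMoment, mul_assoc] using this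

/-- The method of moments for a Gaussian limit. -/
theorem tendstoInDistribution_gaussianReal_of_moment {X : Type*} [MeasurableSpace X]
    {μ : Measure X} [IsProbabilityMeasure μ] {Z : ℕ → X → ℝ} {v : ℝ} (hv : 0 ≤ v)
    (hZ : ∀ T, AEMeasurable (Z T) μ) (hint : ∀ T r, Integrable (fun x => Z T x ^ r) μ)
    (h1 : ∀ T, ∫ x, Z T x ∂μ = 0) (h2 : Tendsto (fun T => ∫ x, Z T x ^ 2 ∂μ) atTop (𝓝 v))
    (h3 : ∀ r : ℕ, Tendsto (fun T => ∫ x, Z T x ^ (r + 2) ∂μ -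
      (r + 1) * ((∫ x, Z T x ^ 2 ∂μ) * ∫ x, Z T x ^ r ∂μ)) atTop (𝓝 0)) :
    TendstoInDistribution Z atTop (id : ℝ → ℝ) (fun _ => μ) (gaussianReal 0 v.toNNReal) := by
  have hm := tendsto_moment_gaussianMoment h1 h2 h3
  refine ⟨hZ, by fun_prop, ?_⟩
  refine ProbabilityMeasure.tendsto_iff_tendsto_charFun.2 fun t => ?_
  have hlim : charFun ((gaussianReal 0 v.toNNReal).map id) t =
      Complex.exp ((-(v * t ^ 2 / 2) : ℝ) : ℂ) := by
    rw [Measure.map_id, charFun_gaussianReal]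
    congr 1
    have : ((v.toNNReal : ℝ) : ℂ) = (v : ℂ) := by rw [Real.coe_toNNReal v hv]
    rw [this]
    push_cast
    ring
  have hchar : ∀ T, charFun (μ.map (Z T)) t = ∫ x, Complex.exp ((t * Z T x : ℝ) * Complex.I) ∂μ := by
    intro T
    rw [charFun_apply_real, integral_map (hZ T) (by fun_prop)]
    push_cast
    rfl
  simp only [ProbabilityMeasure.coe_mk]
  rw [hlim]
  simp_rw [hchar]
  -- The order of truncation is even, so that the absolute moment in the remainder is an ordinary
  -- moment, whose limit is known.
  have hbound : ∀ (n : ℕ) T, ‖(∫ x, Complex.exp ((t * Z T x : ℝ) * Complex.I) ∂μ) -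
      ∑ k ∈ Finset.range (2 * n), (t * Complex.I) ^ k / (k.factorial : ℂ) *
        ((∫ x, Z T x ^ k ∂μ : ℝ) : ℂ)‖ ≤
      t ^ (2 * n) / ((2 * n).factorial : ℝ) * ∫ x, Z T x ^ (2 * n) ∂μ := by
    intro n T
    have hi : ∀ k, Integrable (fun x => (((t * Z T x : ℝ) : ℂ) * Complex.I) ^ k /
        (k.factorial : ℂ)) μ := by
      intro k
      have := (hint T k).ofReal (𝕜 := ℂ)
      have := this.const_mul ((t * Complex.I) ^ k / (k.factorial : ℂ))
      refine this.congr (ae_of_all _ fun x => ?_)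
      simp only [Complex.ofReal_mul, RCLike.ofReal_pow, Complex.coe_algebraMap, mul_pow]
      ring
    have he : Integrable (fun x => Complex.exp ((t * Z T x : ℝ) * Complex.I)) μ := by
      refine Integrable.of_bound (C := 1) ?_ (ae_of_all _ fun x => ?_)
      · have := hZ T
        exact AEMeasurable.aestronglyMeasurable (by fun_prop)
      · rw [Complex.norm_exp_ofReal_mul_I]
    have hs : ∑ k ∈ Finset.range (2 * n), (t * Complex.I) ^ k / (k.factorial : ℂ) *
        ((∫ x, Z T x ^ k ∂μ : ℝ) : ℂ) =
        ∫ x, ∑ k ∈ Finset.range (2 * n), (((t * Z T x : ℝ) : ℂ) * Complex.I) ^ k /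
        (k.factorial : ℂ) ∂μ := by
      rw [integral_finsetSum _ fun k _ => hi k]
      refine Finset.sum_congr rfl fun k _ => ?_
      rw [← integral_complex_ofReal, ← integral_const_mul]
      refine integral_congr_ae (ae_of_all _ fun x => ?_)
      simp only [Complex.ofReal_mul, mul_pow]
      push_cast
      ring
    rw [hs, ← integral_sub he (integrable_finsetSum _ fun k _ => hi k), ← integral_const_mul]
    refine norm_integral_le_of_norm_le ((hint T (2 * n)).const_mul _) (ae_of_all _ fun x => ?_)
    refine (norm_exp_mul_I_sub_taylor_le _ _).trans (le_of_eq ?_)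
    rw [pow_mul, sq_abs, ← pow_mul, mul_pow]
    ring
  rw [Metric.tendsto_nhds]
  intro ε hε
  set w : ℝ := v * t ^ 2 / 2 with hw
  have hS : Tendsto (fun n => ∑ j ∈ Finset.range n, (((-w : ℝ) : ℂ)) ^ j / (j.factorial : ℂ)) atTop
      (𝓝 (Complex.exp ((-w : ℝ) : ℂ))) := by
    rw [Complex.exp_eq_exp_ℂ]
    exact (NormedSpace.expSeries_div_hasSum_exp ((-w : ℝ) : ℂ)).tendsto_sum_nat
  have hW : Tendsto (fun n : ℕ => w ^ n / n.factorial) atTop (𝓝 0) :=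
    FloorSemiring.tendsto_pow_div_factorial_atTop w
  -- The order `n` is fixed before `T`: it makes both the tail of the exponential series and the
  -- limit of the remainder bound less than `ε / 3`.
  obtain ⟨n, hn1, hn2⟩ := ((Metric.tendsto_nhds.1 hS (ε / 3) (by positivity)).and
    (hW.eventually_lt_const (show (0 : ℝ) < ε / 3 by positivity))).exists
  have hA : Tendsto (fun T => ∑ k ∈ Finset.range (2 * n), (t * Complex.I) ^ k / (k.factorial : ℂ) *
        ((∫ x, Z T x ^ k ∂μ : ℝ) : ℂ)) atTop
        (𝓝 (∑ j ∈ Finset.range n, (((-w : ℝ) : ℂ)) ^ j / (j.factorial : ℂ))) := by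
    rw [hw, ← sum_gaussianMoment]
    exact tendsto_finsetSum _ fun k _ =>
      ((Complex.continuous_ofReal.tendsto _).comp (hm k)).const_mul _
  have hB : Tendsto (fun T => t ^ (2 * n) / ((2 * n).factorial : ℝ) * ∫ x, Z T x ^ (2 * n) ∂μ) atTop
      (𝓝 (w ^ n / n.factorial)) := by
    have := (hm (2 * n)).const_mul (t ^ (2 * n) / ((2 * n).factorial : ℝ))
    rw [div_mul_eq_mul_div, mul_div_assoc, gaussianMoment_even, pow_mul, mul_div_assoc',
      ← mul_pow] at this
    rwa [hw, pow_mul, show v * t ^ 2 / 2 = t ^ 2 * (v / 2) by ring]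
  filter_upwards [Metric.tendsto_nhds.1 (hA.sub_const (Complex.exp ((-w : ℝ) : ℂ)))
    (ε / 3 - dist (∑ j ∈ Finset.range n, (((-w : ℝ) : ℂ)) ^ j / (j.factorial : ℂ))
      (Complex.exp ((-w : ℝ) : ℂ))) (by linarith), hB.eventually_lt_const hn2] with T hT1 hT2
  have h3 := hbound n T
  set P := ∫ x, Complex.exp ((t * Z T x : ℝ) * Complex.I) ∂μ
  set Q := ∑ k ∈ Finset.range (2 * n), (t * Complex.I) ^ k / (k.factorial : ℂ) *
        ((∫ x, Z T x ^ k ∂μ : ℝ) : ℂ)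
  rw [dist_sub_right] at hT1
  rw [← dist_eq_norm] at h3
  have := dist_triangle P Q (Complex.exp ((-w : ℝ) : ℂ))
  have := dist_triangle Q (∑ j ∈ Finset.range n, (((-w : ℝ) : ℂ)) ^ j / (j.factorial : ℂ))
    (Complex.exp ((-w : ℝ) : ℂ))
  linarith

/-! ### Clusterings and the volume of clustered tuples -/

/-- The fibres of the idempotent map `κ`, with the points fixed by `κ` as centres, group the points
`h i` into clusters of radius at most `a`, any two of which are at distance at least `b`. -/
structure IsClustering {ι H : Type*} [MetricSpace H] (κ : ι → ι) (h : ι → H) (a b : ℝ) : Prop where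
  idem : ∀ i, κ (κ i) = κ i
  dist_le : ∀ i, dist (h i) (h (κ i)) ≤ a
  le_dist : ∀ i j, κ i ≠ κ j → b ≤ dist (h i) (h j)

/-- As long as two clusters contain points closer than `A * a`, merge them. Each merger lowers the
number of clusters and multiplies the radius by at most `A + 3`, so the process stops within `n`
steps. -/
theorem exists_isClustering_of_card_image_le {ι H : Type*} [Fintype ι] [DecidableEq ι]
    [MetricSpace H] (h : ι → H) {A : ℝ} (hA : 0 ≤ A) (n : ℕ) :
    ∀ (κ : ι → ι) (a : ℝ), 0 ≤ a → (Finset.univ.image κ).card ≤ n → (∀ i, κ (κ i) = κ i) →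
      (∀ i, dist (h i) (h (κ i)) ≤ a) →
      ∃ κ' a', a ≤ a' ∧ a' ≤ (A + 3) ^ n * a ∧ IsClustering κ' h a' (A * a') := by
  induction n with
  | zero =>
    intro κ a ha hcard hidem hdist
    refine ⟨κ, a, le_rfl, by simp, hidem, hdist, fun i j _ => ?_⟩
    simp only [nonpos_iff_eq_zero, Finset.card_eq_zero, Finset.image_eq_empty,
      Finset.univ_eq_empty_iff] at hcard
    exact hcard.elim i
  | succ n ih =>
    intro κ a ha hcard hidem hdist
    have hA1 : 1 ≤ A + 3 := by linarith
    by_cases hsep : ∀ i j, κ i ≠ κ j → A * a ≤ dist (h i) (h j)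
    · exact ⟨κ, a, le_rfl, le_mul_of_one_le_left ha (one_le_pow₀ hA1), hidem, hdist, hsep⟩
    push Not at hsep
    obtain ⟨i, j, hij, hlt⟩ := hsep
    set κ' : ι → ι := fun x => if κ x = κ j then κ i else κ x with hκ'
    have hidem' : ∀ x, κ' (κ' x) = κ' x := by
      intro x
      by_cases hx : κ x = κ j
      · simp [hκ', hx, hidem, hij]
      · simp [hκ', hx, hidem]
    have hdist' : ∀ x, dist (h x) (h (κ' x)) ≤ (A + 3) * a := by
      intro x
      by_cases hx : κ x = κ j
      · simp only [hκ', hx, if_true]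
        have h1 := hdist x
        rw [hx] at h1
        have h2 := hdist j
        have h3 := hdist i
        -- The path from `x` to its new centre goes through its old centre, `j` and `i`: three steps
        -- of length at most `a` and one shorter than `A * a`.
        have h4 := dist_triangle4 (h x) (h (κ j)) (h j) (h i)
        have h5 := dist_triangle (h x) (h i) (h (κ i))
        rw [dist_comm (h (κ j)), dist_comm (h j) (h i)] at h4
        nlinarith
      · simp only [hκ', hx, if_false]
        have := hdist x
        nlinarith [mul_nonneg hA ha]
    have hcard' : (Finset.univ.image κ').card ≤ n := by
      have hss : Finset.univ.image κ' ⊂ Finset.univ.image κ := by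
        refine (Finset.ssubset_iff_of_subset ?_).2 ⟨κ j, by simp, ?_⟩
        · intro y hy
          obtain ⟨x, -, rfl⟩ := Finset.mem_image.1 hy
          by_cases hx : κ x = κ j <;> simp [hκ', hx]
        · intro hmem
          obtain ⟨x, -, hx⟩ := Finset.mem_image.1 hmem
          by_cases hx' : κ x = κ j
          · simp only [hκ', hx', if_true] at hx
            exact hij hx
          · simp only [hκ', hx', if_false] at hx
      have := Finset.card_lt_card hss
      omega
    obtain ⟨κ'', a'', h1, h2, h3⟩ := ih κ' ((A + 3) * a) (by positivity) hcard' hidem' hdist'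
    refine ⟨κ'', a'', (le_mul_of_one_le_left ha hA1).trans h1, h2.trans (le_of_eq ?_), h3⟩
    rw [pow_succ]; ring

theorem exists_isClustering {ι H : Type*} [Fintype ι] [MetricSpace H] (h : ι → H) {A L : ℝ}
    (hA : 0 ≤ A) (hL : 0 ≤ L) :
    ∃ κ a, L ≤ a ∧ a ≤ (A + 3) ^ Fintype.card ι * L ∧ IsClustering κ h a (A * a) := by
  classical
  exact exists_isClustering_of_card_image_le h hA _ id L hL Finset.card_image_le (fun _ => rfl)
    fun i => by simpa using hL

/-- If all fibres of `κ` have at least two elements and one has three, then the image of `κ`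
has fewer than half as many elements as the source. -/
theorem two_mul_card_image_lt {ι : Type*} [Fintype ι] [DecidableEq ι] {κ : ι → ι}
    (h2 : ∀ i, ∃ j, j ≠ i ∧ κ j = κ i)
    {i j k : ι} (hij : i ≠ j) (hik : i ≠ k) (hjk : j ≠ k) (hj : κ j = κ i) (hk : κ k = κ i) :
    2 * (Finset.univ.image κ).card < Fintype.card ι := by
  rw [← Finset.card_univ, Finset.card_eq_sum_card_image κ Finset.univ, mul_comm, ← smul_eq_mul,
    ← Finset.sum_const]
  refine Finset.sum_lt_sum (fun y hy => ?_) ⟨κ i, by simp, ?_⟩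
  · obtain ⟨x, -, rfl⟩ := Finset.mem_image.1 hy
    obtain ⟨z, hz, hzx⟩ := h2 x
    exact Finset.one_lt_card.2 ⟨z, by simp [hzx], x, by simp, hz⟩
  · exact Finset.two_lt_card.2 ⟨i, by simp, j, by simp [hj], k, by simp [hk], hij, hik, hjk⟩

/-- The fixed points of `κ` move freely in `F`; given them, every other coordinate lies in a ball
around its centre, and all balls of radius `ρ` have equal measure by left invariance. -/
theorem measure_pi_clustered_le {ι H : Type*} [Fintype ι] [DecidableEq ι]
    [Group H] [MetricSpace H] [ProperSpace H]
    [IsIsometricSMul H H] [MeasurableSpace H] [BorelSpace H] (m : Measure H) [SigmaFinite m]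
    [m.IsMulLeftInvariant] [MeasurableMul H] {κ : ι → ι} (hκ : ∀ i, κ (κ i) = κ i) {F : Set H}
    (hF : MeasurableSet F) (ρ : ℝ) :
    Measure.pi (fun _ : ι => m) {h | (∀ i, h i ∈ F) ∧ ∀ i, dist (h i) (h (κ i)) ≤ ρ} ≤
      m F ^ (Finset.univ.image κ).card *
        m (Metric.closedBall 1 ρ) ^ (Fintype.card ι - (Finset.univ.image κ).card) := by
  have himage : Finset.univ.image κ = Finset.univ.filter fun i => κ i = i := by
    ext i
    simp only [Finset.mem_image, Finset.mem_univ, true_and, Finset.mem_filter]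
    exact ⟨fun ⟨j, hj⟩ => by rw [← hj, hκ], fun hi => ⟨i, hi⟩⟩
  have hcard : (Finset.univ.image κ).card = Fintype.card {i // κ i = i} := by
    rw [himage, Fintype.card_subtype]
  have hcard' : Fintype.card ι - (Finset.univ.image κ).card = Fintype.card {i // ¬ κ i = i} := by
    rw [hcard, Fintype.card_subtype_compl]
  rw [hcard', hcard]
  set S : Set (({i // κ i = i} → H) × ({i // ¬ κ i = i} → H)) :=
    {z | (∀ i, z.1 i ∈ F) ∧ ∀ j, dist (z.2 j) (z.1 ⟨κ j, hκ j⟩) ≤ ρ} with hS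
  have hSm : MeasurableSet S := by
    have : S = (⋂ i, (fun z => z.1 i) ⁻¹' F) ∩
        ⋂ j, {z | dist (z.2 j) (z.1 ⟨κ j, hκ j⟩) ≤ ρ} := by
      ext z
      simp [hS]
    rw [this]
    refine (MeasurableSet.iInter fun i =>
      ((measurable_pi_apply i).comp measurable_fst) hF).inter ?_
    refine MeasurableSet.iInter fun j => measurableSet_le ?_ measurable_const
    exact Measurable.dist ((measurable_pi_apply j).comp measurable_snd)
      ((measurable_pi_apply _).comp measurable_fst)
  have hmp := measurePreserving_piEquivPiSubtypeProd (fun _ : ι => m) (fun i => κ i = i)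
  have hsub : {h : ι → H | (∀ i, h i ∈ F) ∧ ∀ i, dist (h i) (h (κ i)) ≤ ρ} ⊆
      (MeasurableEquiv.piEquivPiSubtypeProd (fun _ : ι => H) fun i => κ i = i) ⁻¹' S :=
    fun h hh => ⟨fun i => hh.1 i, fun j => hh.2 j⟩
  refine (measure_mono hsub).trans ?_
  rw [hmp.measure_preimage hSm.nullMeasurableSet, Measure.prod_apply hSm]
  have hball : ∀ g : H, m (Metric.closedBall g ρ) = m (Metric.closedBall 1 ρ) := by
    intro g
    rw [← measure_preimage_mul m g (Metric.closedBall g ρ)]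
    congr 1
    ext x
    simp
  calc ∫⁻ u, Measure.pi (fun _ => m) (Prod.mk u ⁻¹' S) ∂(Measure.pi fun _ => m)
      ≤ ∫⁻ u, (Set.univ.pi fun _ : {i // κ i = i} => F).indicator
          (fun _ => m (Metric.closedBall 1 ρ) ^ Fintype.card {i // ¬ κ i = i}) u
          ∂(Measure.pi fun _ => m) := by
        refine lintegral_mono fun u => ?_
        by_cases hu : u ∈ Set.univ.pi fun _ : {i // κ i = i} => F
        · rw [Set.indicator_of_mem hu]
          have : Prod.mk u ⁻¹' S ⊆
              Set.univ.pi fun j : {i // ¬ κ i = i} => Metric.closedBall (u ⟨κ j, hκ j⟩) ρ :=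
            fun w hw j _ => hw.2 j
          refine (measure_mono this).trans ?_
          rw [Measure.pi_pi]
          simp [hball]
        · have : Prod.mk u ⁻¹' S = ∅ := by
            ext w
            simp only [Set.mem_preimage, Set.mem_empty_iff_false, iff_false]
            exact fun hw => hu fun i _ => hw.1 i
          simp [this]
    _ = m F ^ Fintype.card {i // κ i = i} *
        m (Metric.closedBall 1 ρ) ^ Fintype.card {i // ¬ κ i = i} := by
        rw [lintegral_indicator (MeasurableSet.univ_pi fun _ => hF), lintegral_const,
          Measure.restrict_apply_univ, Measure.pi_pi, mul_comm]
        simp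

/-! ### Joint moments -/

/-- The integral of the product of the translates of `g` by the `h i`, `i ∈ S`. -/
noncomputable def jointMoment {H X ι : Type*} [Group H] [MeasurableSpace X] [MulAction H X]
    (μ : Measure X) (g : X → ℝ) (S : Finset ι) (h : ι → H) : ℝ :=
  ∫ x, ∏ i ∈ S, g ((h i)⁻¹ • x) ∂μ

theorem prod_le_pow_card_of_nonneg {ι : Type*} (s : Finset ι) (φ : ι → ℝ) (c : ℝ)
    (h0 : ∀ i ∈ s, 0 ≤ φ i) (hc : ∀ i ∈ s, φ i ≤ c) : ∏ i ∈ s, φ i ≤ c ^ s.card :=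
  (Finset.prod_le_prod h0 hc).trans (by simp)

theorem abs_jointMoment_le {H X ι : Type*} [Group H] [MeasurableSpace X] [MulAction H X]
    {μ : Measure X} [IsProbabilityMeasure μ] {g : X → ℝ} {B : ℝ} (hg : ∀ x, |g x| ≤ B)
    (S : Finset ι) (h : ι → H) : |jointMoment μ g S h| ≤ B ^ S.card := by
  have := norm_integral_le_of_norm_le_const (μ := μ) (C := B ^ S.card)
    (f := fun x => ∏ i ∈ S, g ((h i)⁻¹ • x)) (ae_of_all _ fun x => by
      rw [Real.norm_eq_abs, Finset.abs_prod]
      exact prod_le_pow_card_of_nonneg _ _ _ (fun _ _ => abs_nonneg _) fun i _ => hg _)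
  simpa [jointMoment] using this

theorem abs_jointMoment_le_pow_card {H X ι : Type*} [Fintype ι] [Group H] [MeasurableSpace X]
    [MulAction H X] {μ : Measure X} [IsProbabilityMeasure μ] {g : X → ℝ} {B : ℝ} (hB : 1 ≤ B)
    (hg : ∀ x, |g x| ≤ B) (S : Finset ι) (h : ι → H) :
    |jointMoment μ g S h| ≤ B ^ Fintype.card ι :=
  (abs_jointMoment_le hg S h).trans (pow_le_pow_right₀ hB (Finset.card_le_univ S))

theorem jointMoment_empty {H X ι : Type*} [Group H] [MeasurableSpace X] [MulAction H X]
    {μ : Measure X} [IsProbabilityMeasure μ] (g : X → ℝ) (h : ι → H) :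
    jointMoment μ g ∅ h = 1 := by
  simp [jointMoment]

theorem jointMoment_singleton {H X ι : Type*} [Group H] [MeasurableSpace H] [MeasurableSpace X]
    [MulAction H X] [MeasurableSMul H X] {μ : Measure X} [SMulInvariantMeasure H X μ]
    (g : X → ℝ) (i : ι) (h : ι → H) : jointMoment μ g {i} h = ∫ x, g x ∂μ := by
  simp only [jointMoment, Finset.prod_singleton]
  exact (measurePreserving_smul (h i)⁻¹ μ).integral_comp
    (measurableEmbedding_const_smul (h i)⁻¹) g

theorem le_minDist {H : Type*} [MetricSpace H] {r : ℕ} (hr : 2 ≤ r) {h : Fin r → H} {b : ℝ}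
    (hb : ∀ i j, i ≠ j → b ≤ dist (h i) (h j)) : b ≤ minDist h := by
  have : Nonempty {p : Fin r × Fin r // p.1 ≠ p.2} :=
    ⟨⟨(⟨0, by omega⟩, ⟨1, by omega⟩), by simp⟩⟩
  exact le_ciInf fun p => hb _ _ p.2

/-! ### Factorisation of joint moments from exponential mixing -/

section Mixing

variable {H X ι : Type*} [Group H] [MetricSpace H] [MeasurableSpace H] [MeasurableSpace X]
  [MulAction H X] [MeasurableSMul H X] {μ : Measure X} [SMulInvariantMeasure H X μ]
  {A : InvariantSubalgebra H μ} {N : ℕ → Seminorm ℝ A.toSubmodule} {f : Lp ℝ ∞ μ} {g : X → ℝ}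

/-- Each multiplication costs one order of the norm, and each translation a factor exponential in
the distance. A single `K` serves as factor and as rate, and is any large number, so that finitely
many such estimates can share it. `S` is nonempty because the algebra may lack a unit. -/
theorem IsSobolevFamily.exists_coe_ae_eq_prod [DecidableEq ι] (hN : IsSobolevFamily A N)
    (hf : f ∈ A.toSubmodule) (hgf : g =ᵐ[μ] f) {S : Finset ι} (hS : S.Nonempty) :
    ∀ s, 1 ≤ s → ∀ᶠ K : ℝ in atTop, ∀ (u : ι → H) (a : ℝ), 0 ≤ a → (∀ i ∈ S, dist (u i) 1 ≤ a) →
      ∃ P : A.toSubmodule, ((P : Lp ℝ ∞ μ) =ᵐ[μ] fun x => ∏ i ∈ S, g ((u i)⁻¹ • x)) ∧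
        N s P ≤ K * Real.exp (K * a) := by
  have hsingle : ∀ (i : ι), ∀ s, 1 ≤ s → ∀ᶠ K : ℝ in atTop, ∀ (u : ι → H) (a : ℝ), 0 ≤ a →
      dist (u i) 1 ≤ a →
      ∃ P : A.toSubmodule, ((P : Lp ℝ ∞ μ) =ᵐ[μ] fun x => g ((u i)⁻¹ • x)) ∧
        N s P ≤ K * Real.exp (K * a) := by
    intro i s hs
    obtain ⟨σ, hσ, c, hc⟩ := hN.bounded s hs
    filter_upwards [eventually_ge_atTop σ, eventually_ge_atTop (|c| * N s ⟨f, hf⟩),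
      eventually_ge_atTop 0] with K hK1 hK2 hK0 u a ha hua
    refine ⟨⟨linftyTranslate (u i) f, A.translate_mem _ hf⟩, ?_, ?_⟩
    · have h1 := (measurePreserving_smul (u i)⁻¹ μ).quasiMeasurePreserving.ae_eq_comp hgf
      exact (linftyTranslate_ae_eq (u i) f).trans h1.symm
    · calc _ ≤ c * Real.exp (σ * dist (u i) 1) * N s ⟨f, hf⟩ := hc ⟨f, hf⟩ (u i)
        _ ≤ |c| * Real.exp (K * a) * N s ⟨f, hf⟩ := by
          refine mul_le_mul_of_nonneg_right ?_ (apply_nonneg _ _)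
          refine mul_le_mul (le_abs_self c) (Real.exp_le_exp.2 ?_) (Real.exp_nonneg _)
            (abs_nonneg _)
          exact mul_le_mul hK1 hua dist_nonneg hK0
        _ = |c| * N s ⟨f, hf⟩ * Real.exp (K * a) := by ring
        _ ≤ _ := mul_le_mul_of_nonneg_right hK2 (Real.exp_nonneg _)
  induction hS using Finset.Nonempty.cons_induction with
  | singleton i =>
    intro s hs
    simpa using hsingle i s hs
  | cons i S hi hS ih =>
    intro s hs
    obtain ⟨K, ⟨hK1, hK2⟩, hK0⟩ := (((hsingle i (s + 1) (by omega)).and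
      (ih (s + 1) (by omega))).and (eventually_ge_atTop 0)).exists
    obtain ⟨c, hc⟩ := hN.mul s hs
    filter_upwards [eventually_ge_atTop (|c| * K ^ 2), eventually_ge_atTop (2 * K)]
      with L hL1 hL2 u a ha hua
    obtain ⟨P, hP, hPN⟩ := hK1 u a ha (hua i (by simp))
    obtain ⟨Q, hQ, hQN⟩ := hK2 u a ha fun j hj => hua j (by simp [hj])
    refine ⟨⟨linftyMul (P : Lp ℝ ∞ μ) Q, A.mul_mem P.2 Q.2⟩, ?_, ?_⟩
    · filter_upwards [linftyMul_ae_eq (P : Lp ℝ ∞ μ) Q, hP, hQ] with x h1 h2 h3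
      rw [h1, h2, h3, Finset.prod_cons]
    · calc _ ≤ c * (N (s + 1) P * N (s + 1) Q) := hc P Q
        _ ≤ |c| * ((K * Real.exp (K * a)) * (K * Real.exp (K * a))) := by
          refine mul_le_mul (le_abs_self c) ?_ (by positivity) (abs_nonneg _)
          exact mul_le_mul hPN hQN (apply_nonneg _ _) (by positivity)
        _ = |c| * K ^ 2 * Real.exp (2 * K * a) := by
          rw [show 2 * K * a = K * a + K * a by ring, Real.exp_add]; ring
        _ ≤ _ := by
          refine mul_le_mul hL1 (Real.exp_le_exp.2 ?_) (Real.exp_nonneg _) ?_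
          · exact mul_le_mul_of_nonneg_right hL2 ha
          · exact le_trans (by positivity) hL1

/-- Multiply the translates within each cluster after moving its centre to the identity; the norms
then depend only on the radius `a`. Mixing, applied to these products translated back by the
centres, gains from the separation `b`. -/
theorem ExponentiallyMixing.abs_jointMoment_sub_prod_le [IsProbabilityMeasure μ] [Fintype ι]
    [DecidableEq ι] [IsIsometricSMul H H]
    (hmix : ExponentiallyMixing A N) (hN : IsSobolevFamily A N) (hf : f ∈ A.toSubmodule)
    (hgf : g =ᵐ[μ] f) (S : Finset ι) (κ : ι → ι) :
    ∀ᶠ K : ℝ in atTop, ∀ (h : ι → H) (a b : ℝ), 0 ≤ a → 0 ≤ b → IsClustering κ h a b →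
      |jointMoment μ g S h - ∏ k ∈ S.image κ, jointMoment μ g (S.filter fun i => κ i = k) h| ≤
        K * Real.exp (K * a - b / K) := by
  set J := S.image κ with hJ
  -- Mixing starts at order two; with at most one cluster the factorisation is exact.
  rcases lt_or_ge J.card 2 with hr | hr
  · have : ∀ h : ι → H, jointMoment μ g S h =
        ∏ k ∈ J, jointMoment μ g (S.filter fun i => κ i = k) h := by
      intro h
      rcases Nat.lt_succ_iff.1 hr |>.eq_or_lt with h1 | h1
      · obtain ⟨k, hk⟩ := Finset.card_eq_one.1 h1
        rw [hk, Finset.prod_singleton, Finset.filter_true_of_mem]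
        intro i hi
        have : κ i ∈ J := Finset.mem_image_of_mem κ hi
        simpa [hk] using this
      · have h0 : J = ∅ := Finset.card_eq_zero.1 (by omega)
        rw [h0, Finset.prod_empty, Finset.image_eq_empty.1 h0, jointMoment_empty]
    filter_upwards [eventually_ge_atTop 0] with K hK h a b _ _ _
    rw [this, sub_self, abs_zero]
    positivity
  obtain ⟨δ, hδ, s₀, -, hmix'⟩ := hmix J.card hr
  obtain ⟨c, hc⟩ := hmix' (s₀ + 1) (by omega)
  have hne : ∀ k ∈ J, (S.filter fun i => κ i = k).Nonempty := by
    intro k hk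
    obtain ⟨i, hi, hik⟩ := Finset.mem_image.1 hk
    exact ⟨i, by simp [hi, hik]⟩
  obtain ⟨K, hK, hK0⟩ := (((eventually_all_finset J).2 fun k hk =>
    hN.exists_coe_ae_eq_prod hf hgf (hne k hk) (s₀ + 1) (by omega)).and
      (eventually_ge_atTop 0)).exists
  filter_upwards [eventually_gt_atTop 0, eventually_ge_atTop (|c| * K ^ J.card),
    eventually_ge_atTop (J.card * K), eventually_ge_atTop δ⁻¹] with L hL0 hL1 hL2 hL3 h a b ha hb hκ
  have hchoose : ∀ k ∈ J, ∃ P : A.toSubmodule, ((P : Lp ℝ ∞ μ) =ᵐ[μ]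
      fun x => ∏ i ∈ S.filter (fun i => κ i = k), g (((h k)⁻¹ * h i)⁻¹ • x)) ∧
        N (s₀ + 1) P ≤ K * Real.exp (K * a) := by
    intro k hk
    refine hK k hk (fun i => (h k)⁻¹ * h i) a ha fun i hi => ?_
    obtain ⟨-, hik⟩ := Finset.mem_filter.1 hi
    have := dist_smul (h k)⁻¹ (h i) (h k)
    simp only [smul_eq_mul, inv_mul_cancel] at this
    rw [this, ← hik]
    exact hκ.dist_le i
  choose! P hP hPN using hchoose
  set e := J.equivFin.symm with he
  have hprod : ∀ φ : ι → ℝ, ∏ i : Fin J.card, φ (e i) = ∏ k ∈ J, φ k := by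
    intro φ
    rw [← Finset.prod_coe_sort J φ]
    exact Equiv.prod_comp e fun k : J => φ k
  have hmain := hc (fun i => P (e i)) (fun i => h (e i))
  have hL : ∫ x, ∏ i, ((P (e i) : A.toSubmodule) : Lp ℝ ∞ μ) ((h (e i))⁻¹ • x) ∂μ =
      jointMoment μ g S h := by
    refine integral_congr_ae ?_
    have hae : ∀ k ∈ J, ∀ᵐ x ∂μ, (P k : Lp ℝ ∞ μ) ((h k)⁻¹ • x) =
        ∏ i ∈ S.filter (fun i => κ i = k), g ((h i)⁻¹ • x) := by
      intro k hk
      filter_upwards [(measurePreserving_smul (h k)⁻¹ μ).quasiMeasurePreserving.ae (hP k hk)]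
        with x hx
      rw [hx]
      simp [smul_smul]
    filter_upwards [(eventually_all_finset J).2 hae] with x hx
    rw [hprod fun k => (P k : Lp ℝ ∞ μ) ((h k)⁻¹ • x), Finset.prod_congr rfl hx]
    exact Finset.prod_fiberwise_of_maps_to (fun i hi => Finset.mem_image_of_mem κ hi) _
  have hR : ∏ i, ∫ x, ((P (e i) : A.toSubmodule) : Lp ℝ ∞ μ) x ∂μ =
      ∏ k ∈ J, jointMoment μ g (S.filter fun i => κ i = k) h := by
    rw [hprod fun k => ∫ x, (P k : Lp ℝ ∞ μ) x ∂μ]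
    refine Finset.prod_congr rfl fun k hk => ?_
    rw [integral_congr_ae (hP k hk), jointMoment,
      ← (measurePreserving_smul (h k)⁻¹ μ).integral_comp (measurableEmbedding_const_smul (h k)⁻¹)]
    simp [smul_smul]
  rw [hL, hR] at hmain
  have hmin : b ≤ minDist fun i => h (e i) := by
    refine le_minDist hr fun i j hij => ?_
    have hfix : ∀ k ∈ J, κ k = k := by
      intro k hk
      obtain ⟨i, -, hi⟩ := Finset.mem_image.1 hk
      rw [← hi, hκ.idem]
    refine hκ.le_dist _ _ ?_
    rw [hfix _ (e i).2, hfix _ (e j).2]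
    exact fun h => hij (e.injective (Subtype.ext h))
  calc _ ≤ _ := hmain
    _ ≤ |c| * Real.exp (-δ * b) * (K * Real.exp (K * a)) ^ J.card := by
      refine mul_le_mul (mul_le_mul (le_abs_self c) (Real.exp_le_exp.2 ?_) (Real.exp_nonneg _)
        (abs_nonneg _)) ?_ (Finset.prod_nonneg fun i _ => apply_nonneg _ _) (by positivity)
      · nlinarith
      · rw [hprod fun k => N (s₀ + 1) (P k)]
        exact prod_le_pow_card_of_nonneg _ _ _ (fun _ _ => apply_nonneg _ _) fun k hk => hPN k hk
    _ = |c| * K ^ J.card * Real.exp (J.card * K * a - δ * b) := by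
      rw [mul_pow, ← Real.exp_nat_mul, sub_eq_add_neg, Real.exp_add]
      ring_nf
    _ ≤ _ := by
      refine mul_le_mul hL1 (Real.exp_le_exp.2 ?_) (Real.exp_nonneg _) hL0.le
      have h1 : J.card * K * a ≤ L * a := mul_le_mul_of_nonneg_right hL2 ha
      have h2 : b / L ≤ δ * b := by
        rw [div_eq_inv_mul]
        exact mul_le_mul_of_nonneg_right (inv_le_of_inv_le₀ hδ hL3) hb
      linarith

/-- Joint moments of two families at distance `R` from each other factorise up to an error that is
exponentially small in `R`, whatever the diameters of the families. -/
theorem ExponentiallyMixing.abs_jointMoment_union_sub_le [IsProbabilityMeasure μ] [Fintype ι]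
    [DecidableEq ι] [IsIsometricSMul H H]
    (hmix : ExponentiallyMixing A N) (hN : IsSobolevFamily A N) (hf : f ∈ A.toSubmodule)
    (hgf : g =ᵐ[μ] f) {B : ℝ} (hB : 1 ≤ B) (hg : ∀ x, |g x| ≤ B) (S T : Finset ι) :
    ∀ᶠ K : ℝ in atTop, ∀ (h : ι → H) (R : ℝ), 0 < R →
      (∀ i ∈ S, ∀ j ∈ T, R ≤ dist (h i) (h j)) →
      |jointMoment μ g (S ∪ T) h - jointMoment μ g S h * jointMoment μ g T h| ≤
        K * Real.exp (-(R / K)) := by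
  have hev : ∀ᶠ K : ℝ in atTop, ∀ (U : Finset ι) (κ : ι → ι) (h : ι → H) (a b : ℝ),
      0 ≤ a → 0 ≤ b → IsClustering κ h a b →
      |jointMoment μ g U h - ∏ k ∈ U.image κ, jointMoment μ g (U.filter fun i => κ i = k) h| ≤
        K * Real.exp (K * a - b / K) := by
    simp only [eventually_all]
    exact fun U κ => hmix.abs_jointMoment_sub_prod_le hN hf hgf U κ
  obtain ⟨K, hK, hK1⟩ := (hev.and (eventually_ge_atTop 1)).exists
  set n := Fintype.card ι
  -- With separation `D * a`, the exponent `K * a - D * a / K` equals `-a`.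
  set D := K * (K + 1)
  have hD : 0 ≤ D := by positivity
  -- Clustering from scale `R / Q` keeps the radius below `R / 3`, so no cluster meets both `S` and
  -- `T`.
  set Q := 3 * (D + 3) ^ n with hQ
  have hQ0 : 0 < Q := by positivity
  set C := (B ^ n) ^ n with hC
  have hBn : 1 ≤ B ^ n := one_le_pow₀ hB
  have hC1 : B ^ n ≤ C := by
    rcases Nat.eq_zero_or_pos n with h0 | h0
    · simp [hC, h0]
    · exact le_self_pow₀ hBn h0.ne'
  filter_upwards [eventually_ge_atTop Q, eventually_ge_atTop (K + C * K + C * K)]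
    with L hL1 hL2 h R hR hsep
  obtain ⟨κ, a, ha1, ha2, hκ⟩ := exists_isClustering h hD (L := R / Q) (by positivity)
  have ha : 0 ≤ a := le_trans (by positivity) ha1
  have haR : a ≤ R / 3 := by
    refine ha2.trans (le_of_eq ?_)
    have : (D + 3) ^ n ≠ 0 := by positivity
    change (D + 3) ^ n * (R / Q) = R / 3
    rw [hQ]
    field_simp
  have hdisj : ∀ i ∈ S, ∀ j ∈ T, κ i ≠ κ j := by
    intro i hi j hj hij
    have h1 := hκ.dist_le i
    have h2 := hκ.dist_le j
    have h3 := dist_triangle (h i) (h (κ i)) (h j)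
    rw [hij, dist_comm (h (κ j)), ← hij] at h3
    have := hsep i hi j hj
    rw [hij] at h1 h3
    linarith
  set E := K * Real.exp (-(R / Q))
  have hE0 : 0 ≤ E := by positivity
  have hE : ∀ U : Finset ι, |jointMoment μ g U h -
      ∏ k ∈ U.image κ, jointMoment μ g (U.filter fun i => κ i = k) h| ≤ E := by
    intro U
    refine (hK U κ h a (D * a) ha (by positivity) hκ).trans ?_
    refine mul_le_mul_of_nonneg_left (Real.exp_le_exp.2 ?_) (by positivity)
    have : D * a / K = (K + 1) * a := by
      have : K ≠ 0 := by positivity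
      simp only [D]
      field_simp
    rw [this]
    linarith
  have hP : ∀ U : Finset ι,
      |∏ k ∈ U.image κ, jointMoment μ g (U.filter fun i => κ i = k) h| ≤ C := by
    intro U
    rw [Finset.abs_prod]
    refine (prod_le_pow_card_of_nonneg _ _ (B ^ n) (fun _ _ => abs_nonneg _)
      fun k _ => abs_jointMoment_le_pow_card hB hg _ h).trans ?_
    exact pow_le_pow_right₀ hBn (Finset.card_le_univ _)
  have hST : ∏ k ∈ (S ∪ T).image κ, jointMoment μ g ((S ∪ T).filter fun i => κ i = k) h =
      (∏ k ∈ S.image κ, jointMoment μ g (S.filter fun i => κ i = k) h) *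
        ∏ k ∈ T.image κ, jointMoment μ g (T.filter fun i => κ i = k) h := by
    rw [Finset.image_union, Finset.prod_union]
    · congr 1
      · refine Finset.prod_congr rfl fun k hk => ?_
        obtain ⟨i, hi, rfl⟩ := Finset.mem_image.1 hk
        rw [Finset.filter_union, Finset.filter_false_of_mem (s := T)
          (fun j hj => (hdisj i hi j hj).symm), Finset.union_empty]
      · refine Finset.prod_congr rfl fun k hk => ?_
        obtain ⟨j, hj, rfl⟩ := Finset.mem_image.1 hk
        rw [Finset.filter_union, Finset.filter_false_of_mem (s := S)
          (fun i hi => hdisj i hi j hj), Finset.empty_union]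
    · rw [Finset.disjoint_left]
      intro k hk hk'
      obtain ⟨i, hi, rfl⟩ := Finset.mem_image.1 hk
      obtain ⟨j, hj, hji⟩ := Finset.mem_image.1 hk'
      exact hdisj i hi j hj hji.symm
  have h1 := hE (S ∪ T)
  rw [hST] at h1
  have h2 := hE S
  have h3 := hE T
  have h4 := hP S
  have h5 := (abs_jointMoment_le_pow_card (μ := μ) hB hg T h).trans hC1
  set PS := ∏ k ∈ S.image κ, jointMoment μ g (S.filter fun i => κ i = k) h
  set PT := ∏ k ∈ T.image κ, jointMoment μ g (T.filter fun i => κ i = k) h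
  set MS := jointMoment μ g S h
  set MT := jointMoment μ g T h
  set M := jointMoment μ g (S ∪ T) h
  calc |M - MS * MT| = |(M - PS * PT) - ((MS - PS) * MT + PS * (MT - PT))| := by ring_nf
    _ ≤ |M - PS * PT| + (|MS - PS| * |MT| + |PS| * |MT - PT|) := by
      rw [← abs_mul, ← abs_mul]
      exact (abs_sub _ _).trans (by gcongr; exact abs_add_le _ _)
    _ ≤ E + (E * C + C * E) := by gcongr
    _ = (K + C * K + C * K) * Real.exp (-(R / Q)) := by ring
    _ ≤ L * Real.exp (-(R / L)) := by
      have : 0 ≤ L := hQ0.le.trans hL1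
      gcongr

end Mixing

/-! ### The defect in the Wick recursion -/

/-- The difference between the joint moment of all translates and the first step of its Wick
expansion, in which `o` is paired with another index. -/
noncomputable def wickDefect {H X ι : Type*} [Fintype ι] [DecidableEq ι] [Group H]
    [MeasurableSpace X] [MulAction H X] (μ : Measure X) (g : X → ℝ) (o : ι) (h : ι → H) : ℝ :=
  jointMoment μ g Finset.univ h -
    ∑ j ∈ Finset.univ.erase o, jointMoment μ g {o, j} h * jointMoment μ g ({o, j}ᶜ) h

theorem abs_wickDefect_le {H X ι : Type*} [Fintype ι] [DecidableEq ι] [Group H]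
    [MeasurableSpace X] [MulAction H X] {μ : Measure X} [IsProbabilityMeasure μ] {g : X → ℝ}
    {B : ℝ} (hB : 1 ≤ B) (hg : ∀ x, |g x| ≤ B) (o : ι) (h : ι → H) :
    |wickDefect μ g o h| ≤
      B ^ Fintype.card ι + Fintype.card ι * (B ^ Fintype.card ι * B ^ Fintype.card ι) := by
  have hM := fun S => abs_jointMoment_le_pow_card (μ := μ) hB hg S h
  refine (abs_sub _ _).trans (add_le_add (hM _) ?_)
  refine (Finset.abs_sum_le_sum_abs _ _).trans ?_
  refine (Finset.sum_le_card_nsmul _ _ (B ^ Fintype.card ι * B ^ Fintype.card ι)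
    fun j _ => ?_).trans ?_
  · rw [abs_mul]
    exact mul_le_mul (hM _) (hM _) (abs_nonneg _) (by positivity)
  · rw [nsmul_eq_mul]
    gcongr
    exact Finset.card_le_univ _

theorem ExponentiallyMixing.abs_wickDefect_le_or_isClustering
    {H X ι : Type*} [Group H] [MetricSpace H] [MeasurableSpace H] [MeasurableSpace X]
    [MulAction H X] [MeasurableSMul H X] {μ : Measure X} [SMulInvariantMeasure H X μ]
    {A : InvariantSubalgebra H μ} {N : ℕ → Seminorm ℝ A.toSubmodule} {f : Lp ℝ ∞ μ} {g : X → ℝ}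
    [IsProbabilityMeasure μ] [Fintype ι] [DecidableEq ι] [IsIsometricSMul H H]
    (hmix : ExponentiallyMixing A N) (hN : IsSobolevFamily A N) (hf : f ∈ A.toSubmodule)
    (hgf : g =ᵐ[μ] f) {B : ℝ} (hB : 1 ≤ B) (hg : ∀ x, |g x| ≤ B) (hg0 : ∫ x, g x ∂μ = 0) (o : ι) :
    ∀ᶠ K : ℝ in atTop, ∀ (h : ι → H) (R : ℝ), 0 < R →
      |wickDefect μ g o h| ≤ K * Real.exp (-(R / K)) ∨
      ∃ κ : ι → ι, (∀ i, κ (κ i) = κ i) ∧ 2 * (Finset.univ.image κ).card < Fintype.card ι ∧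
        ∀ i, dist (h i) (h (κ i)) ≤ 4 ^ Fintype.card ι * R := by
  have hev : ∀ᶠ K : ℝ in atTop, ∀ (S T : Finset ι) (h : ι → H) (R : ℝ), 0 < R →
      (∀ i ∈ S, ∀ j ∈ T, R ≤ dist (h i) (h j)) →
      |jointMoment μ g (S ∪ T) h - jointMoment μ g S h * jointMoment μ g T h| ≤
        K * Real.exp (-(R / K)) := by
    simp only [eventually_all]
    exact fun S T => hmix.abs_jointMoment_union_sub_le hN hf hgf hB hg S T
  obtain ⟨K, hK, hK0⟩ := (hev.and (eventually_gt_atTop 0)).exists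
  set n := Fintype.card ι with hn
  filter_upwards [eventually_ge_atTop K, eventually_ge_atTop (K + n * (B ^ n * K))]
    with L hL1 hL2 h R hR
  set E := K * Real.exp (-(R / K)) with hE
  have hE0 : 0 ≤ E := by positivity
  have hBn : 1 ≤ B ^ n := one_le_pow₀ hB
  have hM := fun S => abs_jointMoment_le_pow_card (μ := μ) hB hg S h
  have hfinal : ∀ D₀ : ℝ, ∀ φ : ι → ℝ, ∀ U : Finset ι, |D₀| ≤ E → (∀ j ∈ U, |φ j| ≤ B ^ n * E) →
      |D₀ - ∑ j ∈ U, φ j| ≤ L * Real.exp (-(R / L)) := by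
    intro D₀ φ U h1 h2
    calc |D₀ - ∑ j ∈ U, φ j| ≤ |D₀| + |∑ j ∈ U, φ j| := abs_sub _ _
      _ ≤ E + n * (B ^ n * E) := by
        refine add_le_add h1 ?_
        refine (Finset.abs_sum_le_sum_abs _ _).trans ?_
        refine (Finset.sum_le_card_nsmul _ _ _ h2).trans ?_
        rw [nsmul_eq_mul]
        gcongr
        exact Finset.card_le_univ _
      _ = (K + n * (B ^ n * K)) * Real.exp (-(R / K)) := by rw [hE]; ring
      _ ≤ L * Real.exp (-(R / L)) := by
        have : 0 ≤ L := hK0.le.trans hL1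
        gcongr
  have hisol : ∀ (U : Finset ι) (i : ι), i ∈ U → (∀ j ∈ U, j ≠ i → R ≤ dist (h i) (h j)) →
      |jointMoment μ g U h| ≤ E := by
    intro U i hi hj
    have := hK {i} (U.erase i) h R hR (by
      intro i' hi' j hj'
      rw [Finset.mem_singleton.1 hi']
      exact hj j (Finset.mem_of_mem_erase hj') (Finset.ne_of_mem_erase hj'))
    rw [← Finset.insert_eq, Finset.insert_erase hi, jointMoment_singleton, hg0, zero_mul,
      sub_zero] at this
    exact this
  -- Separation equal to the radius bound suffices here, because the factorisation over two families
  -- does not see their diameters. The ratio 1 yields the constant `4 ^ n`.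
  obtain ⟨κ, a, ha1, ha2, hκ⟩ := exists_isClustering h zero_le_one hR.le
  have hsep : ∀ i j, κ i ≠ κ j → R ≤ dist (h i) (h j) := fun i j hij =>
    (ha1.trans (by rw [one_mul])).trans (hκ.le_dist i j hij)
  have hmul : ∀ x y : ℝ, |x| ≤ E → |y| ≤ B ^ n → |x * y| ≤ B ^ n * E := by
    intro x y hx hy
    rw [abs_mul, mul_comm]
    exact mul_le_mul hy hx (abs_nonneg _) (by positivity)
  -- A point `i` alone in its cluster lies in `{o, j}` or in its complement, so every product has a
  -- small factor.
  by_cases h1 : ∃ i, ∀ j, j ≠ i → κ j ≠ κ i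
  · obtain ⟨i, hi⟩ := h1
    have hiso : ∀ U : Finset ι, i ∈ U → |jointMoment μ g U h| ≤ E := fun U hiU =>
      hisol U i hiU fun j _ hj => hsep i j (hi j hj).symm
    left
    refine hfinal _ _ _ (hiso _ (Finset.mem_univ i)) fun j _ => ?_
    by_cases hij : i ∈ ({o, j} : Finset ι)
    · exact hmul _ _ (hiso _ hij) (hM _)
    · rw [mul_comm]
      exact hmul _ _ (hiso _ (Finset.mem_compl.2 hij)) (hM _)
  push Not at h1
  obtain ⟨p, hpo, hp⟩ := h1 o
  by_cases h2 : ∃ k, k ≠ o ∧ k ≠ p ∧ κ k = κ o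
  · obtain ⟨k, hko, hkp, hk⟩ := h2
    right
    refine ⟨κ, hκ.idem, two_mul_card_image_lt h1 hpo.symm hko.symm hkp.symm hp hk, fun i => ?_⟩
    refine (hκ.dist_le i).trans (ha2.trans (le_of_eq ?_))
    rw [show (1 : ℝ) + 3 = 4 by norm_num]
  push Not at h2
  left
  -- Now the cluster of `o` is exactly `{o, p}`. The term of `p` is split off to cancel the full
  -- moment; in the others `o` is far from `j`.
  rw [wickDefect, ← Finset.add_sum_erase (Finset.univ.erase o) _ (a := p) (by simp [hpo]),
    ← sub_sub]
  refine hfinal _ _ _ ?_ fun j hj => ?_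
  · have := hK {o, p} {o, p}ᶜ h R hR (by
      intro i hi j hj
      simp only [Finset.mem_insert, Finset.mem_singleton, Finset.mem_compl, not_or] at hi hj
      have hjo := h2 j hj.1 hj.2
      rcases hi with rfl | rfl
      · exact hsep _ _ hjo.symm
      · exact hsep _ _ (by rw [hp]; exact hjo.symm))
    rwa [Finset.union_compl] at this
  · simp only [Finset.mem_erase, Finset.mem_univ, and_true] at hj
    refine hmul _ _ (hisol _ o (by simp) fun k hk hko => ?_) (hM _)
    simp only [Finset.mem_insert, Finset.mem_singleton] at hk
    rcases hk with rfl | rfl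
    · exact absurd rfl hko
    · exact hsep _ _ (h2 k hj.2 hj.1).symm

/-! ### Moments of averages as integrals of joint moments -/

section Integrals

variable {H X ι : Type*} [Group H] [MeasurableSpace H] [MeasurableInv H]
  [MeasurableSpace X] [MulAction H X] [MeasurableSMul₂ H X] {μ : Measure X}
  [IsProbabilityMeasure μ] {g : X → ℝ} {B : ℝ}

theorem measurable_jointMoment (hgm : Measurable g) (S : Finset ι) :
    Measurable fun h : ι → H => jointMoment μ g S h := by
  have : Measurable fun p : (ι → H) × X => ∏ i ∈ S, g ((p.1 i)⁻¹ • p.2) :=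
    Finset.measurable_fun_prod _ fun i _ =>
      hgm.comp ((((measurable_pi_apply i).comp measurable_fst).inv).smul measurable_snd)
  exact (this.stronglyMeasurable.integral_prod_right (ν := μ)).measurable

theorem integrable_jointMoment_mul [Fintype ι] (hgm : Measurable g) (hB : 1 ≤ B)
    (hg : ∀ x, |g x| ≤ B) (ν : Measure (ι → H)) [IsFiniteMeasure ν] (S T : Finset ι) :
    Integrable (fun h : ι → H => jointMoment μ g S h * jointMoment μ g T h) ν := by
  refine Integrable.of_bound (C := B ^ Fintype.card ι * B ^ Fintype.card ι)
    ((measurable_jointMoment hgm S).mul (measurable_jointMoment hgm T)).aestronglyMeasurable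
    (ae_of_all _ fun h => ?_)
  rw [norm_mul]
  exact mul_le_mul (abs_jointMoment_le_pow_card hB hg _ h) (abs_jointMoment_le_pow_card hB hg _ h)
    (norm_nonneg _) (by positivity)

theorem integrable_jointMoment [Fintype ι] (hgm : Measurable g) (hB : 1 ≤ B)
    (hg : ∀ x, |g x| ≤ B) (ν : Measure (ι → H)) [IsFiniteMeasure ν] (S : Finset ι) :
    Integrable (fun h : ι → H => jointMoment μ g S h) ν :=
  Integrable.of_bound (measurable_jointMoment hgm S).aestronglyMeasurable _
    (ae_of_all _ fun h => abs_jointMoment_le_pow_card hB hg _ h)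

/-- Write the product of two integrals over `X` as one over `X × X` and exchange it with the
integral over tuples; for a fixed pair of points the integrand is a product over the coordinates. -/
theorem integral_jointMoment_mul_compl [Fintype ι] [DecidableEq ι] (hgm : Measurable g)
    (hg : ∀ x, |g x| ≤ B) (ν : Measure H) [IsFiniteMeasure ν] (S : Finset ι) :
    ∫ h : ι → H, jointMoment μ g S h * jointMoment μ g Sᶜ h ∂(Measure.pi fun _ => ν) =
      (∫ x, (∫ t, g (t⁻¹ • x) ∂ν) ^ S.card ∂μ) * ∫ x, (∫ t, g (t⁻¹ • x) ∂ν) ^ Sᶜ.card ∂μ := by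
  have hprod : ∀ (φ ψ : ι → ℝ), ∏ i, (if i ∈ S then φ i else ψ i) =
      (∏ i ∈ S, φ i) * ∏ i ∈ Sᶜ, ψ i := by
    intro φ ψ
    rw [Finset.prod_ite]
    congr 2
    · ext i; simp
    · ext i; simp
  set G : (ι → H) → X × X → ℝ := fun h z =>
    ∏ i, (if i ∈ S then g ((h i)⁻¹ • z.1) else g ((h i)⁻¹ • z.2)) with hG
  have h1 : ∀ h, jointMoment μ g S h * jointMoment μ g Sᶜ h = ∫ z, G h z ∂(μ.prod μ) := by
    intro h
    simp only [hG, hprod]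
    exact (integral_prod_mul (fun x => ∏ i ∈ S, g ((h i)⁻¹ • x))
      (fun x => ∏ i ∈ Sᶜ, g ((h i)⁻¹ • x))).symm
  have hmeas : Measurable (Function.uncurry G) := by
    refine Finset.measurable_fun_prod _ fun i _ => ?_
    by_cases hi : i ∈ S
    · simp only [hi, if_true]
      exact hgm.comp ((((measurable_pi_apply i).comp measurable_fst).inv).smul
        (measurable_fst.comp measurable_snd))
    · simp only [hi, if_false]
      exact hgm.comp ((((measurable_pi_apply i).comp measurable_fst).inv).smul
        (measurable_snd.comp measurable_snd))
  have hint : Integrable (Function.uncurry G) ((Measure.pi fun _ => ν).prod (μ.prod μ)) := by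
    refine Integrable.of_bound (C := B ^ Fintype.card ι) hmeas.aestronglyMeasurable
      (ae_of_all _ fun p => ?_)
    simp only [Function.uncurry, hG]
    rw [Real.norm_eq_abs, Finset.abs_prod]
    refine prod_le_pow_card_of_nonneg _ _ _ (fun _ _ => abs_nonneg _) fun i _ => ?_
    split_ifs <;> exact hg _
  simp_rw [h1]
  rw [integral_integral_swap hint]
  have h2 : ∀ z : X × X, ∫ h, G h z ∂(Measure.pi fun _ => ν) =
      (∫ t, g (t⁻¹ • z.1) ∂ν) ^ S.card * (∫ t, g (t⁻¹ • z.2) ∂ν) ^ Sᶜ.card := by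
    intro z
    have := integral_fintype_prod_eq_prod (μ := fun _ : ι => ν) (𝕜 := ℝ) (fun (i : ι) (t : H) =>
      if i ∈ S then g (t⁻¹ • z.1) else g (t⁻¹ • z.2))
    rw [this]
    have : ∀ i, (∫ t, (if i ∈ S then g (t⁻¹ • z.1) else g (t⁻¹ • z.2)) ∂ν) =
        if i ∈ S then ∫ t, g (t⁻¹ • z.1) ∂ν else ∫ t, g (t⁻¹ • z.2) ∂ν := by
      intro i
      split_ifs <;> rfl
    simp_rw [this]
    rw [hprod, Finset.prod_const, Finset.prod_const]
  simp_rw [h2]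
  exact integral_prod_mul (fun x => (∫ t, g (t⁻¹ • x) ∂ν) ^ S.card)
    (fun x => (∫ t, g (t⁻¹ • x) ∂ν) ^ Sᶜ.card)

theorem integral_wickDefect [Fintype ι] [DecidableEq ι] (hgm : Measurable g) (hB : 1 ≤ B)
    (hg : ∀ x, |g x| ≤ B) (ν : Measure H) [IsFiniteMeasure ν] (o : ι) :
    ∫ h, wickDefect μ g o h ∂(Measure.pi fun _ : ι => ν) =
      ∫ x, (∫ t, g (t⁻¹ • x) ∂ν) ^ Fintype.card ι ∂μ -
        ((Fintype.card ι - 1 : ℕ) : ℝ) * ((∫ x, (∫ t, g (t⁻¹ • x) ∂ν) ^ 2 ∂μ) *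
          ∫ x, (∫ t, g (t⁻¹ • x) ∂ν) ^ (Fintype.card ι - 2) ∂μ) := by
  simp only [wickDefect]
  rw [integral_sub (integrable_jointMoment hgm hB hg _ _)
    (integrable_finsetSum _ fun _ _ => integrable_jointMoment_mul hgm hB hg _ _ _),
    integral_finsetSum _ fun _ _ => integrable_jointMoment_mul hgm hB hg _ _ _]
  congr 1
  · have := integral_jointMoment_mul_compl (μ := μ) hgm hg ν (Finset.univ : Finset ι)
    simpa [jointMoment_empty] using this
  · rw [Finset.sum_congr rfl (g := fun _ => (∫ x, (∫ t, g (t⁻¹ • x) ∂ν) ^ 2 ∂μ) *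
      ∫ x, (∫ t, g (t⁻¹ • x) ∂ν) ^ (Fintype.card ι - 2) ∂μ)]
    · simp
    · intro j hj
      have hoj : o ≠ j := fun h => by simp [h] at hj
      rw [integral_jointMoment_mul_compl hgm hg, Finset.card_compl, Finset.card_pair hoj]

end Integrals

theorem ExponentiallyMixing.exists_moment_recursion_bound {H X : Type*} [Group H] [MetricSpace H]
    [IsTopologicalGroup H] [ProperSpace H] [IsIsometricSMul H H] [MeasurableSpace H] [BorelSpace H]
    (m : Measure H) [m.IsHaarMeasure] [MeasurableSpace X] [MulAction H X] [MeasurableSMul₂ H X]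
    {μ : Measure X} [IsProbabilityMeasure μ] [SMulInvariantMeasure H X μ]
    {A : InvariantSubalgebra H μ} {N : ℕ → Seminorm ℝ A.toSubmodule} {f : Lp ℝ ∞ μ} {g : X → ℝ}
    (hmix : ExponentiallyMixing A N) (hN : IsSobolevFamily A N) (hf : f ∈ A.toSubmodule)
    (hgf : g =ᵐ[μ] f) (hgm : Measurable g) {B : ℝ} (hB : 1 ≤ B) (hg : ∀ x, |g x| ≤ B)
    (hg0 : ∫ x, g x ∂μ = 0) (r : ℕ) :
    ∃ K : ℝ, 0 < K ∧ ∀ (F : Set H) (R : ℝ), IsCompact F → 1 ≤ m.real F → 0 < R →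
      |∫ x, (∫ t in F, g (t⁻¹ • x) ∂m) ^ (r + 2) ∂μ -
        (r + 1) * ((∫ x, (∫ t in F, g (t⁻¹ • x) ∂m) ^ 2 ∂μ) *
          ∫ x, (∫ t in F, g (t⁻¹ • x) ∂m) ^ r ∂μ)| ≤
      K * Real.exp (-(R / K)) * m.real F ^ (r + 2) +
        K * (Real.sqrt (m.real F) ^ (r + 1) *
          max 1 (m.real (Metric.closedBall 1 (4 ^ (r + 2) * R))) ^ (r + 2)) := by
  set n := r + 2 with hn
  obtain ⟨K, hK, hK0⟩ := ((hmix.abs_wickDefect_le_or_isClustering (ι := Fin n) hN hf hgf hB hg hg0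
    0).and (eventually_gt_atTop 0)).exists
  simp only [Fintype.card_fin] at hK
  set C := B ^ n + n * (B ^ n * B ^ n) with hC
  have hC0 : 0 ≤ C := by positivity
  have hCb : ∀ h : Fin n → H, |wickDefect μ g 0 h| ≤ C := by
    intro h
    simpa using abs_wickDefect_le (μ := μ) hB hg 0 h
  set c := (Fintype.card (Fin n → Fin n) : ℝ) with hc
  set L := max K (c * C) with hL
  have hL0 : 0 < L := lt_max_of_lt_left hK0
  refine ⟨L, hL0, fun F R hF hV hR => ?_⟩
  have hFm : MeasurableSet F := hF.isClosed.measurableSet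
  have hFfin : m F < ∞ := hF.measure_lt_top
  have : IsFiniteMeasure (m.restrict F) := ⟨by simpa using hFfin⟩
  have hI := integral_wickDefect (μ := μ) hgm hB hg (m.restrict F) (0 : Fin n)
  simp only [Fintype.card_fin] at hI
  have e1 : ((n - 1 : ℕ) : ℝ) = r + 1 := by
    rw [hn, show r + 2 - 1 = r + 1 by omega]; push_cast; ring
  have e2 : n - 2 = r := by omega
  rw [e1, e2] at hI
  rw [← hI]
  set ρ := 4 ^ n * R
  set β := max 1 (m.real (Metric.closedBall 1 ρ)) with hβ
  set V := m.real F with hVdef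
  set P : Measure (Fin n → H) := Measure.pi fun _ => m.restrict F with hP
  -- Tuples clustered along `κ`. Only the patterns `κ` in the finite set `good`, with fewer than `n
  -- / 2` clusters, are needed: off the union of their `bad` sets the defect is exponentially small.
  set bad : (Fin n → Fin n) → Set (Fin n → H) := fun κ =>
    {h | ∀ i, dist (h i) (h (κ i)) ≤ ρ} with hbad
  have hbadm : ∀ κ, MeasurableSet (bad κ) := by
    intro κ
    have : bad κ = ⋂ i, {h | dist (h i) (h (κ i)) ≤ ρ} := by ext; simp [hbad]
    rw [this]
    exact MeasurableSet.iInter fun i => measurableSet_le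
      ((measurable_pi_apply i).dist (measurable_pi_apply (κ i))) measurable_const
  set good : Finset (Fin n → Fin n) := Finset.univ.filter fun κ =>
    (∀ i, κ (κ i) = κ i) ∧ 2 * (Finset.univ.image κ).card < n with hgood
  have hvol : ∀ κ ∈ good, P.real (bad κ) ≤ Real.sqrt V ^ (r + 1) * β ^ n := by
    intro κ hκ
    obtain ⟨-, hidem, hcard⟩ := Finset.mem_filter.1 hκ
    have hle := measure_pi_clustered_le m hidem hFm ρ
    have hPle : P (bad κ) ≤ Measure.pi (fun _ : Fin n => m)
        {h | (∀ i, h i ∈ F) ∧ ∀ i, dist (h i) (h (κ i)) ≤ ρ} := by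
      rw [hP, ← Measure.restrict_pi_pi, Measure.restrict_apply (hbadm κ)]
      exact measure_mono fun h hh => ⟨fun i => hh.2 i trivial, hh.1⟩
    have hbfin : m (Metric.closedBall (1 : H) ρ) < ∞ :=
      (isCompact_closedBall (1 : H) ρ).measure_lt_top
    have := ENNReal.toReal_mono (ENNReal.mul_ne_top (ENNReal.pow_ne_top hFfin.ne)
      (ENNReal.pow_ne_top hbfin.ne)) (hPle.trans hle)
    rw [ENNReal.toReal_mul, ENNReal.toReal_pow, ENNReal.toReal_pow] at this
    refine this.trans (mul_le_mul ?_ ?_ (by positivity) (by positivity))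
    · change V ^ _ ≤ _
      have hs : 1 ≤ Real.sqrt V := Real.one_le_sqrt.2 hV
      calc V ^ (Finset.univ.image κ).card = Real.sqrt V ^ (2 * (Finset.univ.image κ).card) := by
            rw [pow_mul, Real.sq_sqrt (by positivity)]
        -- Twice the number of clusters is an integer below `r + 2`, hence at most `r + 1`: this
        -- saves one factor `√V`.
        _ ≤ _ := pow_le_pow_right₀ hs (by omega)
    · calc _ ≤ β ^ _ := pow_le_pow_left₀ ENNReal.toReal_nonneg (le_max_right _ _) _
        _ ≤ β ^ n := pow_le_pow_right₀ (le_max_left _ _) (by simp)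
  have hPuniv : P.real Set.univ = V ^ n := by
    simp [hP, Measure.real, Measure.pi_univ, hVdef]
  set E := K * Real.exp (-(R / K)) with hE
  have hEL : E ≤ L * Real.exp (-(R / L)) := by
    have : K ≤ L := le_max_left _ _
    rw [hE]
    gcongr
  have hpoint : ∀ h, ‖wickDefect μ g 0 h‖ ≤ E + ∑ κ ∈ good, (bad κ).indicator (fun _ => C) h := by
    intro h
    have hnn : ∀ κ ∈ good, 0 ≤ (bad κ).indicator (fun _ => C) h :=
      fun κ _ => Set.indicator_nonneg (fun _ _ => hC0) _
    rcases hK h R hR with h1 | ⟨κ, h1, h2, h3⟩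
    · exact h1.trans (le_add_of_nonneg_right (Finset.sum_nonneg hnn))
    · have hκ : κ ∈ good := Finset.mem_filter.2 ⟨Finset.mem_univ _, h1, h2⟩
      have := Finset.single_le_sum hnn hκ
      rw [Set.indicator_of_mem (show h ∈ bad κ from h3)] at this
      have hE0 : 0 ≤ E := by positivity
      exact (hCb h).trans (by linarith)
  have hind : ∀ κ ∈ good, Integrable ((bad κ).indicator fun _ => C) P :=
    fun κ _ => (integrable_const C).indicator (hbadm κ)
  have hint2 : Integrable (fun h => ∑ κ ∈ good, (bad κ).indicator (fun _ => C) h) P :=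
    integrable_finsetSum _ hind
  have hmain := norm_integral_le_of_norm_le ((integrable_const E).add hint2) (ae_of_all P hpoint)
  rw [← Real.norm_eq_abs]
  refine hmain.trans ?_
  simp only [Pi.add_apply]
  rw [integral_add (integrable_const E) hint2, integral_const, hPuniv, integral_finsetSum _ hind]
  refine add_le_add ?_ ?_
  · rw [smul_eq_mul, mul_comm]
    exact mul_le_mul_of_nonneg_right hEL (by positivity)
  · calc ∑ κ ∈ good, ∫ h, (bad κ).indicator (fun _ => C) h ∂P
        ≤ ∑ κ ∈ good, C * (Real.sqrt V ^ (r + 1) * β ^ n) := by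
          refine Finset.sum_le_sum fun κ hκ => ?_
          rw [integral_indicator (hbadm κ), setIntegral_const, smul_eq_mul, mul_comm]
          exact mul_le_mul_of_nonneg_left (hvol κ hκ) hC0
      _ ≤ c * (C * (Real.sqrt V ^ (r + 1) * β ^ n)) := by
          rw [Finset.sum_const, nsmul_eq_mul]
          gcongr
          exact Nat.cast_le.2 (Finset.card_le_univ good)
      _ ≤ _ := by
          rw [← mul_assoc]
          gcongr
          exact le_max_right _ _

/-! ### Consequences of subexponential growth -/

theorem SubexponentialGrowth.eventually_measureReal_closedBall_le {H : Type*} [Group H]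
    [MetricSpace H] [ProperSpace H] [MeasurableSpace H] {m : Measure H}
    [IsFiniteMeasureOnCompacts m]
    (hgrowth : SubexponentialGrowth H m) {η : ℝ} (hη : 0 < η) :
    ∀ᶠ ρ : ℝ in atTop, max 1 (m.real (Metric.closedBall 1 ρ)) ≤ Real.exp (η * ρ) := by
  -- Rate `η / 2` at radius `2 * ρ`: doubling the radius passes from closed to open balls.
  have h1 : ∀ᶠ r : ℝ in atTop, ((Real.log (m.real (Metric.ball (1 : H) r)) / r : ℝ) : EReal) <
      ((η / 2 : ℝ) : EReal) := by
    refine eventually_lt_of_limsup_lt ?_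
    rw [hgrowth]
    exact_mod_cast half_pos hη
  have h2 : Tendsto (fun ρ : ℝ => 2 * ρ) atTop atTop := tendsto_id.const_mul_atTop two_pos
  filter_upwards [h2.eventually h1, eventually_gt_atTop 0] with ρ h hρ
  rw [EReal.coe_lt_coe_iff, div_lt_iff₀ (by positivity)] at h
  refine max_le (Real.one_le_exp (by positivity)) ?_
  have hsub : m.real (Metric.closedBall (1 : H) ρ) ≤ m.real (Metric.ball (1 : H) (2 * ρ)) := by
    refine measureReal_mono (Metric.closedBall_subset_ball (by linarith)) ?_
    exact ((measure_mono Metric.ball_subset_closedBall).trans_lt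
      (isCompact_closedBall (1 : H) (2 * ρ)).measure_lt_top).ne
  refine hsub.trans ?_
  -- For a ball of measure zero the logarithm is the default value 0 and carries no information, so
  -- this case is separate.
  rcases eq_or_lt_of_le (measureReal_nonneg (μ := m) (s := Metric.ball (1 : H) (2 * ρ)))
    with h0 | h0
  · rw [← h0]
    exact (Real.exp_pos _).le
  · rw [← Real.log_le_iff_le_exp h0]
    linarith

/-- Cut `H` into shells by the integer part of the distance to the identity. Growth at rate `c / 2`
leaves a geometric series of ratio `exp(-c / 2)`. -/
theorem SubexponentialGrowth.integrable_exp_neg_dist {H : Type*} [Group H] [MetricSpace H]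
    [ProperSpace H] [MeasurableSpace H] [BorelSpace H] {m : Measure H}
    [IsFiniteMeasureOnCompacts m] (hgrowth : SubexponentialGrowth H m) {c : ℝ} (hc : 0 < c) :
    Integrable (fun h : H => Real.exp (-(c * dist h 1))) m := by
  refine ⟨Measurable.aestronglyMeasurable (by fun_prop), ?_⟩
  rw [hasFiniteIntegral_iff_norm]
  have hsum : Summable fun k : ℕ =>
      Real.exp (-(c * k)) * m.real (Metric.closedBall (1 : H) (k + 1)) := by
    have hgeo : Summable fun k : ℕ => Real.exp (c / 2) * Real.exp (-(c / 2)) ^ k :=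
      (summable_geometric_of_lt_one (Real.exp_nonneg _)
        (Real.exp_lt_one_iff.2 (by linarith))).mul_left _
    refine Summable.of_norm_bounded_eventually_nat hgeo ?_
    have ht : Tendsto (fun k : ℕ => (k : ℝ) + 1) atTop atTop :=
      tendsto_atTop_add_const_right _ _ tendsto_natCast_atTop_atTop
    filter_upwards [ht.eventually (hgrowth.eventually_measureReal_closedBall_le (half_pos hc))]
      with k hk
    have := (le_max_right _ _).trans hk
    rw [Real.norm_of_nonneg (by positivity)]
    refine (mul_le_mul_of_nonneg_left this (Real.exp_nonneg _)).trans (le_of_eq ?_)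
    rw [← Real.exp_nat_mul, ← Real.exp_add, ← Real.exp_add]
    congr 1
    ring
  calc ∫⁻ h, ENNReal.ofReal ‖Real.exp (-(c * dist h 1))‖ ∂m
      ≤ ∫⁻ h, ∑' k : ℕ, (Metric.closedBall (1 : H) (k + 1)).indicator
          (fun _ => ENNReal.ofReal (Real.exp (-(c * k)))) h ∂m := by
        refine lintegral_mono fun h => ?_
        refine le_trans ?_ (ENNReal.le_tsum ⌊dist h 1⌋₊)
        rw [Set.indicator_of_mem, Real.norm_of_nonneg (Real.exp_nonneg _)]
        · refine ENNReal.ofReal_le_ofReal (Real.exp_le_exp.2 ?_)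
          have := Nat.floor_le (dist_nonneg (x := h) (y := 1))
          nlinarith
        · exact Metric.mem_closedBall.2 (Nat.lt_floor_add_one _).le
    _ = ∑' k : ℕ, ENNReal.ofReal
          (Real.exp (-(c * k)) * m.real (Metric.closedBall (1 : H) (k + 1))) := by
        rw [lintegral_tsum fun k => (measurable_const.indicator
          Metric.isClosed_closedBall.measurableSet).aemeasurable]
        refine tsum_congr fun k => ?_
        rw [lintegral_indicator Metric.isClosed_closedBall.measurableSet, setLIntegral_const,
          ENNReal.ofReal_mul (Real.exp_nonneg _), Measure.real, ENNReal.ofReal_toReal]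
        exact (isCompact_closedBall (1 : H) _).measure_lt_top.ne
    _ = ENNReal.ofReal (∑' k : ℕ,
          Real.exp (-(c * k)) * m.real (Metric.closedBall (1 : H) (k + 1))) :=
        (ENNReal.ofReal_tsum_of_nonneg (fun k => by positivity) hsum).symm
    _ < ∞ := ENNReal.ofReal_lt_top

/-! ### Autocorrelation and the limiting variance -/

theorem autocorrelation_eq_jointMoment {H X : Type*} [Group H] [MeasurableSpace H]
    [MeasurableSpace X] [MulAction H X] [MeasurableSMul H X] {μ : Measure X}
    [SMulInvariantMeasure H X μ] {f : Lp ℝ ∞ μ} {g : X → ℝ} (hgf : g =ᵐ[μ] f) (h : H) :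
    autocorrelation f h = jointMoment μ g (Finset.univ : Finset (Fin 2)) ![1, h] := by
  refine integral_congr_ae ?_
  filter_upwards [hgf, (measurePreserving_smul h⁻¹ μ).quasiMeasurePreserving.ae hgf] with x h1 h2
  simp [Fin.prod_univ_two, h1, h2]

theorem autocorrelation_inv_mul {H X : Type*} [Group H] [MeasurableSpace H]
    [MeasurableSpace X] [MulAction H X] [MeasurableSMul H X] {μ : Measure X}
    [SMulInvariantMeasure H X μ] {f : Lp ℝ ∞ μ} {g : X → ℝ} (hgf : g =ᵐ[μ] f) (h k : H) :
    autocorrelation f (h⁻¹ * k) = ∫ x, g (h⁻¹ • x) * g (k⁻¹ • x) ∂μ := by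
  rw [autocorrelation,
    ← (measurePreserving_smul h⁻¹ μ).integral_comp (measurableEmbedding_const_smul h⁻¹)]
  refine integral_congr_ae ?_
  filter_upwards [(measurePreserving_smul h⁻¹ μ).quasiMeasurePreserving.ae hgf,
    (measurePreserving_smul k⁻¹ μ).quasiMeasurePreserving.ae hgf] with x h1 h2
  simp [h1, h2, smul_smul]

theorem measurable_autocorrelation {H X : Type*} [Group H] [MeasurableSpace H] [MeasurableInv H]
    [MeasurableSpace X] [MulAction H X] [MeasurableSMul₂ H X] {μ : Measure X}
    [IsProbabilityMeasure μ] [SMulInvariantMeasure H X μ] {f : Lp ℝ ∞ μ} {g : X → ℝ} (hgf : g =ᵐ[μ] f) (hgm : Measurable g) :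
    Measurable fun h : H => autocorrelation f h := by
  simp_rw [autocorrelation_eq_jointMoment hgf]
  refine (measurable_jointMoment (μ := μ) hgm _).comp (measurable_pi_lambda _ fun i => ?_)
  fin_cases i
  · exact measurable_const
  · exact measurable_id

section Autocorrelation

variable {H X : Type*} [Group H] [MetricSpace H]
  [IsTopologicalGroup H] [ProperSpace H] [MeasurableSpace H] [BorelSpace H]
  {m : Measure H} [m.IsHaarMeasure] [MeasurableSpace X] [MulAction H X] [MeasurableSMul₂ H X]
  {μ : Measure X} [IsProbabilityMeasure μ] [SMulInvariantMeasure H X μ]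
  {A : InvariantSubalgebra H μ} {N : ℕ → Seminorm ℝ A.toSubmodule} {f : Lp ℝ ∞ μ} {g : X → ℝ}
  {B : ℝ}

theorem ExponentiallyMixing.integrable_autocorrelation [IsIsometricSMul H H]
    (hmix : ExponentiallyMixing A N)
    (hN : IsSobolevFamily A N) (hf : f ∈ A.toSubmodule) (hgf : g =ᵐ[μ] f) (hgm : Measurable g)
    (hB : 1 ≤ B) (hg : ∀ x, |g x| ≤ B) (hg0 : ∫ x, g x ∂μ = 0)
    (hgrowth : SubexponentialGrowth H m) : Integrable (fun h : H => autocorrelation f h) m := by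
  obtain ⟨K, ⟨hK, hKB⟩, hK0⟩ := (((hmix.abs_jointMoment_union_sub_le (ι := Fin 2) hN hf hgf hB hg
    {0} {1}).and (eventually_ge_atTop (B ^ 2))).and (eventually_gt_atTop 0)).exists
  refine ((hgrowth.integrable_exp_neg_dist (inv_pos.2 hK0)).const_mul K).mono'
    (measurable_autocorrelation hgf hgm).aestronglyMeasurable (ae_of_all _ fun h => ?_)
  rw [autocorrelation_eq_jointMoment hgf, Real.norm_eq_abs]
  -- Factorisation needs a positive distance; at the identity the trivial bound `B ^ 2 ≤ K` is used.
  rcases eq_or_ne h 1 with rfl | hne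
  · have := abs_jointMoment_le (μ := μ) hg (Finset.univ : Finset (Fin 2)) ![(1 : H), 1]
    simpa using this.trans (by simpa using hKB)
  · have := hK ![1, h] (dist h 1) (dist_pos.2 hne) (by simp [dist_comm])
    rw [jointMoment_singleton, hg0, zero_mul, sub_zero, div_eq_inv_mul] at this
    exact this

/-- Invariance of `μ` turns the second moment into a double integral of the autocorrelation at `h⁻¹
* k`. Substituting `h * k` for `k`, by left invariance of `m`, leaves as weight the measure of those
`h` in `F` with `h * k` in `F`. -/
theorem integral_sq_setIntegral_eq (hgf : g =ᵐ[μ] f) (hgm : Measurable g)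
    (hg : ∀ x, |g x| ≤ B) (hint : Integrable (fun h : H => autocorrelation f h) m) {F : Set H}
    (hF : IsCompact F) :
    ∫ x, (∫ t in F, g (t⁻¹ • x) ∂m) ^ 2 ∂μ =
      ∫ k, autocorrelation f k * m.real (F ∩ (fun x => x * k) ⁻¹' F) ∂m := by
  have hFm : MeasurableSet F := hF.isClosed.measurableSet
  have hFfin : m F < ∞ := hF.measure_lt_top
  have : IsFiniteMeasure (m.restrict F) := ⟨by simpa using hFfin⟩
  have h1 : ∀ x, (∫ t in F, g (t⁻¹ • x) ∂m) ^ 2 =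
      ∫ p, g (p.1⁻¹ • x) * g (p.2⁻¹ • x) ∂((m.restrict F).prod (m.restrict F)) := by
    intro x
    rw [sq]
    exact (integral_prod_mul (fun t : H => g (t⁻¹ • x)) (fun t : H => g (t⁻¹ • x))).symm
  have hint1 : Integrable (Function.uncurry fun (x : X) (p : H × H) =>
      g (p.1⁻¹ • x) * g (p.2⁻¹ • x)) (μ.prod ((m.restrict F).prod (m.restrict F))) := by
    refine Integrable.of_bound (C := B * B) (Measurable.aestronglyMeasurable ?_)
      (ae_of_all _ fun p => ?_)
    · exact (hgm.comp ((measurable_fst.comp measurable_snd).inv.smul measurable_fst)).mul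
        (hgm.comp ((measurable_snd.comp measurable_snd).inv.smul measurable_fst))
    · simp only [Function.uncurry]
      rw [norm_mul]
      exact mul_le_mul (hg _) (hg _) (norm_nonneg _) ((abs_nonneg _).trans (hg p.1))
  simp_rw [h1]
  rw [integral_integral_swap hint1]
  simp_rw [← autocorrelation_inv_mul hgf]
  have ham := measurable_autocorrelation (H := H) hgf hgm
  have hcb : ∀ k : H, |autocorrelation f k| ≤ B ^ 2 := by
    intro k
    rw [autocorrelation_eq_jointMoment hgf]
    simpa using abs_jointMoment_le (μ := μ) hg (Finset.univ : Finset (Fin 2)) ![(1 : H), k]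
  rw [integral_prod (f := fun p : H × H => autocorrelation f (p.1⁻¹ * p.2))]
  swap
  · exact Integrable.of_bound (C := B ^ 2)
      (ham.comp (measurable_fst.inv.mul measurable_snd)).aestronglyMeasurable
      (ae_of_all _ fun p => hcb _)
  have h2 : ∀ h : H, ∫ k in F, autocorrelation f (h⁻¹ * k) ∂m =
      ∫ k, F.indicator 1 (h * k) * autocorrelation f k ∂m := by
    intro h
    rw [← integral_indicator hFm, ← integral_mul_left_eq_self _ h]
    refine integral_congr_ae (ae_of_all _ fun k => ?_)
    by_cases hk : h * k ∈ F <;> simp [hk]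
  simp_rw [h2]
  have hint2 : Integrable (Function.uncurry fun h k : H =>
      F.indicator (1 : H → ℝ) (h * k) * autocorrelation f k) ((m.restrict F).prod m) := by
    have := (integrable_const (1 : ℝ) (μ := m.restrict F)).mul_prod hint
    refine this.mono (Measurable.aestronglyMeasurable ?_) (ae_of_all _ fun p => ?_)
    · exact ((measurable_one.indicator hFm).comp (measurable_fst.mul measurable_snd)).mul
        (ham.comp measurable_snd)
    · simp only [Function.uncurry, norm_mul]
      refine mul_le_mul_of_nonneg_right ?_ (norm_nonneg _)
      by_cases hk : p.1 * p.2 ∈ F <;> simp [hk]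
  rw [integral_integral_swap hint2]
  refine integral_congr_ae (ae_of_all _ fun k => ?_)
  simp only
  rw [integral_mul_const, mul_comm]
  congr 1
  have hpre : MeasurableSet ((fun x : H => x * k) ⁻¹' F) := measurable_mul_const k hFm
  have : (fun h : H => F.indicator (1 : H → ℝ) (h * k)) =
      ((fun x : H => x * k) ⁻¹' F).indicator 1 := rfl
  rw [this, integral_indicator_one hpre, measureReal_restrict_apply hpre, Set.inter_comm]

theorem IsRightFolner.tendsto_integral_sq (hgf : g =ᵐ[μ] f) (hgm : Measurable g)
    (hg : ∀ x, |g x| ≤ B) (hint : Integrable (fun h : H => autocorrelation f h) m)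
    {F : ℕ → Set H} (hF : IsRightFolner m F) :
    Tendsto (fun T => (∫ x, (∫ t in F T, g (t⁻¹ • x) ∂m) ^ 2 ∂μ) / m.real (F T)) atTop
      (𝓝 (∫ h, autocorrelation f h ∂m)) := by
  have hfin : ∀ T, m (F T) ≠ ∞ := fun T => (hF.isCompact T).measure_lt_top.ne
  have hpos : ∀ T, 0 < m.real (F T) := by
    intro T
    refine ENNReal.toReal_pos ?_ (hfin T)
    exact (Measure.measure_pos_of_nonempty_interior m (hF.interior_nonempty T)).ne'
  set w : ℕ → H → ℝ := fun T k => m.real (F T ∩ (fun x => x * k) ⁻¹' F T) / m.real (F T) with hw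
  have hw1 : ∀ T k, w T k ≤ 1 := fun T k =>
    div_le_one_of_le₀ (measureReal_mono Set.inter_subset_left (hfin T)) (hpos T).le
  have hw0 : ∀ T k, 0 ≤ w T k := fun T k => by positivity
  have heq : ∀ T, (∫ x, (∫ t in F T, g (t⁻¹ • x) ∂m) ^ 2 ∂μ) / m.real (F T) =
      ∫ k, autocorrelation f k * w T k ∂m := by
    intro T
    rw [integral_sq_setIntegral_eq hgf hgm hg hint (hF.isCompact T), ← integral_div]
    simp only [hw, mul_div_assoc]
  have hwlim : ∀ k, Tendsto (fun T => w T k) atTop (𝓝 1) := by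
    intro k
    -- The preimage of `F T` under right multiplication by `k` is its right translate by `k⁻¹`,
    -- whence the inverse.
    have h1 := (ENNReal.tendsto_toReal ENNReal.zero_ne_top).comp (hF.tendsto_symmDiff k⁻¹)
    have h2 : Tendsto (fun T => 1 -
        (m (symmDiff (F T) ((fun x => x * k⁻¹) '' F T)) / m (F T)).toReal) atTop (𝓝 1) := by
      simpa using h1.const_sub 1
    suffices hle : ∀ T, 1 - (m (symmDiff (F T) ((fun x => x * k⁻¹) '' F T)) / m (F T)).toReal ≤
        w T k from tendsto_of_tendsto_of_tendsto_of_le_of_le h2 tendsto_const_nhds hle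
          fun T => hw1 T k
    intro T
    have himg : (fun x : H => x * k⁻¹) '' F T = (fun x => x * k) ⁻¹' F T := by
      ext x
      simp
    rw [himg, ENNReal.toReal_div, sub_le_iff_le_add, hw]
    simp only
    rw [Measure.real, Measure.real, ← add_div, le_div_iff₀ (show 0 < (m (F T)).toReal from hpos T), one_mul]
    have hcomp : IsCompact ((fun x : H => x * k⁻¹) '' F T) :=
      (hF.isCompact T).image (continuous_mul_const _)
    have hfin' : m ((fun x : H => x * k) ⁻¹' F T) ≠ ∞ := himg ▸ hcomp.measure_lt_top.ne
    have hsd : m (symmDiff (F T) ((fun x : H => x * k) ⁻¹' F T)) ≠ ∞ :=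
      ((measure_mono (symmDiff_le_sup (a := F T) (b := (fun x : H => x * k) ⁻¹' F T))).trans_lt
        ((measure_union_le _ _).trans_lt (ENNReal.add_lt_top.2
          ⟨(hfin T).lt_top, hfin'.lt_top⟩))).ne
    rw [← ENNReal.toReal_add (ne_top_of_le_ne_top (hfin T) (measure_mono Set.inter_subset_left))
      hsd]
    refine ENNReal.toReal_mono (ENNReal.add_ne_top.2
      ⟨ne_top_of_le_ne_top (hfin T) (measure_mono Set.inter_subset_left), hsd⟩) ?_
    refine (measure_mono fun x hx => ?_).trans (measure_union_le _ _)
    by_cases hx' : x ∈ (fun x => x * k) ⁻¹' F T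
    · exact Or.inl ⟨hx, hx'⟩
    · exact Or.inr (Or.inl ⟨hx, hx'⟩)
  simp_rw [heq]
  refine tendsto_integral_of_dominated_convergence (fun k => |autocorrelation f k|) (fun T => ?_)
    hint.abs (fun T => ae_of_all _ fun k => ?_) (ae_of_all _ fun k => ?_)
  · have hFm := (hF.isCompact T).isClosed.measurableSet
    have hs : MeasurableSet {p : H × H | p.2 ∈ F T ∧ p.2 * p.1 ∈ F T} :=
      (measurable_snd hFm).inter ((measurable_snd.mul measurable_fst) hFm)
    have hwm : Measurable (w T) :=
      ((measurable_measure_prodMk_left (ν := m) hs).ennreal_toReal).div_const _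
    exact ((measurable_autocorrelation hgf hgm).mul hwm).aestronglyMeasurable
  · rw [norm_mul, Real.norm_eq_abs, Real.norm_of_nonneg (hw0 T k)]
    exact mul_le_of_le_one_right (abs_nonneg _) (hw1 T k)
  · simpa using (hwlim k).const_mul (autocorrelation f k)

end Autocorrelation

/-! ### Representatives, choice of the radius and conclusion -/

theorem Lp_ae_abs_le_norm {X : Type*} [MeasurableSpace X] {μ : Measure X} (f : Lp ℝ ∞ μ) :
    ∀ᵐ x ∂μ, |f x| ≤ ‖f‖ := by
  have hfin : eLpNorm f ∞ μ ≠ ∞ := (Lp.memLp f).2.ne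
  filter_upwards [ae_le_eLpNormEssSup (f := f) (μ := μ)] with x hx
  rw [← eLpNorm_exponent_top] at hx
  rw [Lp.norm_def, ← Real.norm_eq_abs, ← toReal_enorm]
  exact ENNReal.toReal_mono hfin hx

/-- Truncating at the norm gives a bound at every point. The bound is taken at least 1 so that its
powers increase. -/
theorem exists_measurable_bounded_ae_eq {X : Type*} [MeasurableSpace X] {μ : Measure X}
    (f : Lp ℝ ∞ μ) :
    ∃ (g : X → ℝ) (B : ℝ), g =ᵐ[μ] f ∧ Measurable g ∧ 1 ≤ B ∧ ∀ x, |g x| ≤ B := by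
  set B := max 1 ‖f‖ with hB
  have hB1 : 1 ≤ B := le_max_left _ _
  refine ⟨fun x => max (-B) (min B (f x)), B, ?_, ?_, hB1, fun x => ?_⟩
  · filter_upwards [Lp_ae_abs_le_norm f] with x hx
    have := abs_le.1 (hx.trans (le_max_right 1 ‖f‖))
    rw [min_eq_right this.2, max_eq_right this.1]
  · exact measurable_const.max (measurable_const.min (Lp.stronglyMeasurable f).measurable)
  · exact abs_le.2 ⟨le_max_left _ _, max_le (by linarith) (min_le_left _ _)⟩

/-- The exceptional null set depends on `t`; Fubini exchanges the quantifiers over `t` and `x`. -/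
theorem integral_setIntegral_ae_eq {H X : Type*} [Group H] [MeasurableSpace H] [MeasurableInv H]
    [MeasurableSpace X] [MulAction H X] [MeasurableSMul₂ H X] {μ : Measure X} [SFinite μ]
    [SMulInvariantMeasure H X μ] {f g : X → ℝ} (hfm : Measurable f) (hgm : Measurable g)
    (hgf : g =ᵐ[μ] f) (ν : Measure H) [SFinite ν] :
    ∀ᵐ x ∂μ, ∫ t, g (t⁻¹ • x) ∂ν = ∫ t, f (t⁻¹ • x) ∂ν := by
  have hsm : Measurable fun p : H × X => p.1⁻¹ • p.2 := measurable_fst.inv.smul measurable_snd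
  have hset : MeasurableSet {p : H × X | g (p.1⁻¹ • p.2) = f (p.1⁻¹ • p.2)} :=
    measurableSet_eq_fun (hgm.comp hsm) (hfm.comp hsm)
  have h := (Measure.ae_ae_comm (μ := ν) (ν := μ) hset).1 (ae_of_all _ fun t =>
    (measurePreserving_smul t⁻¹ μ).quasiMeasurePreserving.ae hgf)
  filter_upwards [h] with x hx
  exact integral_congr_ae hx

/-- Balls of radius comparable to `log V` are negligible compared to powers of `V` in a group of
subexponential growth; with exponentially small errors, this makes the right hand side of the
moment recursion negligible compared to `V ^ (n / 2)`. -/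
theorem SubexponentialGrowth.exists_radius {H : Type*} [Group H] [MetricSpace H]
    [ProperSpace H] [MeasurableSpace H] {m : Measure H} [IsFiniteMeasureOnCompacts m]
    (hgrowth : SubexponentialGrowth H m) {K : ℝ} (hK : 0 < K) (r : ℕ) :
    ∀ᶠ V : ℝ in atTop, ∃ R : ℝ, 0 < R ∧
      (K * Real.exp (-(R / K)) * V ^ (r + 2) + K * (Real.sqrt V ^ (r + 1) *
          max 1 (m.real (Metric.closedBall 1 (4 ^ (r + 2) * R))) ^ (r + 2))) /
        Real.sqrt V ^ (r + 2) ≤ 2 * K * Real.exp (-(Real.log V / 4)) := by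
  set n := r + 2 with hn
  -- With `R = q log V`, `exp(-R / K)` equals `V ^ (-(n / 2 + 1))`, so the first term is of order
  -- `V⁻¹` after division.
  set q : ℝ := K * (n / 2 + 1) with hq
  have hq0 : 0 < q := by positivity
  have hn0 : (0 : ℝ) < n := by rw [hn]; positivity
  -- Chosen so that the ball factor is at most `V ^ (1 / 4)`; the second term is then at most `K * V
  -- ^ (1 / 4 - 1 / 2)`.
  set η : ℝ := 1 / (4 * n * 4 ^ n * q) with hη
  have hη0 : 0 < η := by positivity
  have hR : Tendsto (fun V => 4 ^ n * (q * Real.log V)) atTop atTop :=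
    (Real.tendsto_log_atTop.const_mul_atTop hq0).const_mul_atTop (by positivity)
  filter_upwards [hR.eventually (hgrowth.eventually_measureReal_closedBall_le hη0),
    eventually_gt_atTop 1] with V hV hV1
  have hL : 0 < Real.log V := Real.log_pos hV1
  refine ⟨q * Real.log V, by positivity, ?_⟩
  set L := Real.log V with hLdef
  have hVL : V = Real.exp L := (Real.exp_log (by linarith)).symm
  have hsq : Real.sqrt V = Real.exp (L / 2) := by rw [hVL, Real.exp_half]
  set β := max 1 (m.real (Metric.closedBall (1 : H) (4 ^ n * (q * L)))) with hβ
  have hβ1 : 1 ≤ β := le_max_left _ _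
  have hβn : β ^ n ≤ Real.exp (L / 4) := by
    refine (pow_le_pow_left₀ (by linarith) hV n).trans (le_of_eq ?_)
    rw [← Real.exp_nat_mul]
    congr 1
    rw [hη]
    field_simp
  have h1 : K * Real.exp (-(q * L / K)) * V ^ n / Real.exp (L / 2) ^ n = K * Real.exp (-L) := by
    rw [hVL, ← Real.exp_nat_mul, ← Real.exp_nat_mul, mul_assoc, ← Real.exp_add, mul_div_assoc,
      ← Real.exp_sub]
    congr 2
    rw [hq]
    field_simp
    ring
  have h2 : K * (Real.exp (L / 2) ^ (r + 1) * β ^ n) / Real.exp (L / 2) ^ n ≤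
      K * Real.exp (-(L / 4)) := by
    have : K * (Real.exp (L / 2) ^ (r + 1) * β ^ n) / Real.exp (L / 2) ^ n =
        K * (β ^ n * Real.exp (-(L / 2))) := by
      rw [hn, Real.exp_neg]
      field_simp
      ring
    rw [this]
    refine mul_le_mul_of_nonneg_left ?_ hK.le
    calc β ^ n * Real.exp (-(L / 2)) ≤ Real.exp (L / 4) * Real.exp (-(L / 2)) := by gcongr
      _ = Real.exp (-(L / 4)) := by rw [← Real.exp_add]; ring_nf
  rw [hsq, add_div, h1]
  have h3 : K * Real.exp (-L) ≤ K * Real.exp (-(L / 4)) := by gcongr; linarith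
  linarith

theorem theorem1p1 {H X : Type*}
    [Group H] [MetricSpace H] [IsTopologicalGroup H] [ProperSpace H] [IsIsometricSMul H H]
    [MeasurableSpace H] [BorelSpace H] (m : Measure H) [m.IsHaarMeasure]
    [MeasurableSpace X] [MulAction H X] [MeasurableSMul₂ H X]
    (μ : Measure X) [IsProbabilityMeasure μ] [SMulInvariantMeasure H X μ]
    (A : InvariantSubalgebra H μ) (N : ℕ → Seminorm ℝ A.toSubmodule)
    (hN : IsSobolevFamily A N) (hmix : ExponentiallyMixing A N)
    (hgrowth : SubexponentialGrowth H m)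
    (F : ℕ → Set H) (hF : IsRightFolner m F)
    (hFtop : Tendsto (fun T => m (F T)) atTop (𝓝 ∞))
    (f : Lp ℝ ∞ μ) (hfA : f ∈ A.toSubmodule) (hf : ∫ x, f x ∂μ = 0) :
    Integrable (fun h : H => autocorrelation f h) m ∧
      0 ≤ ∫ h : H, autocorrelation f h ∂m ∧
      TendstoInDistribution (fun T x => normalizedAverage m (F T) f x) atTop (id : ℝ → ℝ)
        (fun _ => μ) (gaussianReal 0 (∫ h : H, autocorrelation f h ∂m).toNNReal) := by
  obtain ⟨g, B, hgf, hgm, hB, hg⟩ := exists_measurable_bounded_ae_eq f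
  have hg0 : ∫ x, g x ∂μ = 0 := (integral_congr_ae hgf).trans hf
  have hint := hmix.integrable_autocorrelation hN hfA hgf hgm hB hg hg0 hgrowth
  have hvar := hF.tendsto_integral_sq hgf hgm hg hint
  have hfinite : ∀ T, IsFiniteMeasure (m.restrict (F T)) := fun T =>
    ⟨by simpa using (hF.isCompact T).measure_lt_top⟩
  -- The variance is a limit of normalised second moments.
  have hv : 0 ≤ ∫ h : H, autocorrelation f h ∂m :=
    ge_of_tendsto' hvar fun T => div_nonneg (integral_nonneg fun x => sq_nonneg _)
      measureReal_nonneg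
  refine ⟨hint, hv, ?_⟩
  set S : ℕ → X → ℝ := fun T x => ∫ t in F T, g (t⁻¹ • x) ∂m with hS
  have hgm2 : Measurable fun p : X × H => g (p.2⁻¹ • p.1) :=
    hgm.comp (measurable_snd.inv.smul measurable_fst)
  have hSm : ∀ T, Measurable (S T) := fun T =>
    (hgm2.stronglyMeasurable.integral_prod_right (ν := m.restrict (F T))).measurable
  have hSb : ∀ T x, |S T x| ≤ B * m.real (F T) := by
    intro T x
    have := norm_integral_le_of_norm_le_const (μ := m.restrict (F T)) (C := B)
      (f := fun t : H => g (t⁻¹ • x)) (ae_of_all _ fun t : H => hg (t⁻¹ • x))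
    simpa using this
  set Z : ℕ → X → ℝ := fun T x => (Real.sqrt (m.real (F T)))⁻¹ * S T x with hZ
  have hZm : ∀ T, Measurable (Z T) := fun T => (hSm T).const_mul _
  have hZpow : ∀ T k, ∫ x, Z T x ^ k ∂μ = (∫ x, S T x ^ k ∂μ) / Real.sqrt (m.real (F T)) ^ k := by
    intro T k
    simp only [hZ, mul_pow]
    rw [integral_const_mul, inv_pow, div_eq_inv_mul]
  have hZint : ∀ T k, Integrable (fun x => Z T x ^ k) μ := by
    intro T k
    refine Integrable.of_bound (C := ((Real.sqrt (m.real (F T)))⁻¹ * (B * m.real (F T))) ^ k)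
      ((hZm T).pow_const k).aestronglyMeasurable (ae_of_all _ fun x => ?_)
    rw [norm_pow, norm_mul, Real.norm_of_nonneg (by positivity)]
    exact pow_le_pow_left₀ (by positivity) (mul_le_mul_of_nonneg_left (hSb T x) (by positivity)) k
  have hVtop : Tendsto (fun T => m.real (F T)) atTop atTop := by
    refine tendsto_atTop.2 fun c => ?_
    filter_upwards [hFtop.eventually_const_lt (ENNReal.ofReal_lt_top (r := c))] with T hT
    exact (ENNReal.ofReal_le_iff_le_toReal (hF.isCompact T).measure_lt_top.ne).1 hT.le
  have hZ1 : ∀ T, ∫ x, Z T x ∂μ = 0 := by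
    intro T
    -- With one index and empty complement the identity expresses the mean of `S T`, which vanishes
    -- because `g` has mean zero.
    have h := integral_jointMoment_mul_compl (μ := μ) (ι := Fin 1) hgm hg (m.restrict (F T))
      Finset.univ
    have h0 : ∀ h : Fin 1 → H, jointMoment μ g Finset.univ h = 0 := fun h => by
      rw [Finset.univ_unique, jointMoment_singleton, hg0]
    simp only [h0, zero_mul, integral_zero, Finset.compl_univ] at h
    have h' := hZpow T 1
    simp only [pow_one] at h'
    rw [h', show ∫ x, S T x ∂μ = 0 by simpa using h.symm, zero_div]
  have hZ2 : Tendsto (fun T => ∫ x, Z T x ^ 2 ∂μ) atTop (𝓝 (∫ h : H, autocorrelation f h ∂m)) := by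
    refine hvar.congr fun T => ?_
    rw [hZpow, Real.sq_sqrt measureReal_nonneg]
  have hZ3 : ∀ r : ℕ, Tendsto (fun T => ∫ x, Z T x ^ (r + 2) ∂μ -
      (r + 1) * ((∫ x, Z T x ^ 2 ∂μ) * ∫ x, Z T x ^ r ∂μ)) atTop (𝓝 0) := by
    intro r
    obtain ⟨K, hK, hrec⟩ :=
      hmix.exists_moment_recursion_bound m hN hfA hgf hgm hB hg hg0 r
    have hlim : Tendsto (fun T => 2 * K * Real.exp (-(Real.log (m.real (F T)) / 4))) atTop
        (𝓝 0) := by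
      have h1 : Tendsto (fun T => Real.log (m.real (F T)) / 4) atTop atTop :=
        (Real.tendsto_log_atTop.comp hVtop).atTop_div_const (by norm_num)
      simpa using (Real.tendsto_exp_neg_atTop_nhds_zero.comp h1).const_mul (2 * K)
    refine squeeze_zero_norm' ?_ hlim
    filter_upwards [hVtop.eventually (hgrowth.exists_radius hK r),
      hVtop.eventually_ge_atTop 1] with T ⟨R, hR, hle⟩ hV
    refine le_trans ?_ hle
    have hs : 0 < Real.sqrt (m.real (F T)) := Real.sqrt_pos.2 (by linarith)
    rw [hZpow, hZpow, hZpow, le_div_iff₀ (by positivity), Real.norm_eq_abs]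
    refine le_trans (le_of_eq ?_) (hrec (F T) R (hF.isCompact T) hV hR)
    rw [← abs_of_pos (pow_pos hs (r + 2)), ← abs_mul, abs_of_pos (pow_pos hs (r + 2))]
    congr 1
    change _ = ∫ x, S T x ^ (r + 2) ∂μ -
      (r + 1) * ((∫ x, S T x ^ 2 ∂μ) * ∫ x, S T x ^ r ∂μ)
    rw [pow_add _ r 2]
    field_simp
  have hlimit := tendstoInDistribution_gaussianReal_of_moment hv (fun T => (hZm T).aemeasurable)
    hZint hZ1 hZ2 hZ3
  -- Return from the representative `g` to `f`.
  refine hlimit.congr (fun T => ?_) (ae_eq_refl _)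
  filter_upwards [integral_setIntegral_ae_eq (Lp.stronglyMeasurable f).measurable hgm hgf
    (m.restrict (F T))] with x hx
  simp only [hZ, hS, normalizedAverage, hx]
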